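/- Let $M$ be a connected matroid on a finite ground set $E$ (one whose ground set is nonempty and in which any two distinct elements lie in a common circuit). Let $$\mathbb S=\Bigl\{w\in\mathbb R^E : \sum_{i\in E} w_i=0,\ \sum_{i\in E} w_i^2=1\Bigr\}.$$ **Bergman complex.** The Bergman fan $\widetilde{\mathcal B}(M)$ is the set of all $w\in\mathbb R^E$ such that, for every circuit $C$ of $M$, the minimum of $\{w_i: i\in C\}$ is attained at least twice. For $w\in\mathbb R^E$ let $M_w$ be the matroid whose bases are the bases $\sigma$ of $M$ maximizing $\sum_{i\in\sigma}w_i$, and let $\Gamma_w$ be the closure of $\{w'\in\mathbb R^E: M_{w'}=M_w\}$; the cones $\Gamma_w$ form the normal fan of the matroid polytope of $M$. The Bergman complex $\mathcal B(M)$ is the complex of spherical polytopes with faces $\Gamma_w\cap\mathbb S$, $w\in\widetilde{\mathcal B}(M)$. **Minimal nested set complex.** Let $\mathcal L_M$ be the lattice of flats of $M$, with least element $\hat 0$ and greatest element $\hat 1=E$, and let $\mathcal G_{\min}$ be the set of all $X>\hat 0$ in $\mathcal L_M$ whose lower interval $[\hat 0,X]$ is not isomorphic to a product of two posets with more than one element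 each. A set $\mathcal S\subseteq\mathcal G_{\min}$ is nested if, for any $t\ge 2$ distinct pairwise incomparable $X_1,\dots,X_t\in\mathcal S$, the join $X_1\vee\dots\vee X_t$ is not in $\mathcal G_{\min}$. The nested set complex $\mathcal N(M)=\mathcal N(\mathcal L_M,\mathcal G_{\min})$ consists of all $\mathcal S$ with $\hat 1\notin\mathcal S$ such that $\mathcal S\cup\{\hat 1\}$ is nested. It is realized on $\mathbb S$ by assigning to $\mathcal S$ the spherical simplex $$\bigl(\mathbb R_{\ge 0}\{v_F: F\in\mathcal S\}+\mathbb R(1,\dots,1)\bigr)\cap\mathbb S,$$ where $v_F\in\{0,1\}^E$ is the incidence vector of the flat $F$. **Theorem.** The spherical complexes $\mathcal N(M)$ and $\mathcal B(M)$ are equal, that is, they have the same set of faces in $\mathbb S$, if and only if for every pair of flats $F\subsetneq G$ of $M$ such that $G$ is connected (i.e. the restriction $M|G$ is a connected matroid), the matroid $M[F,G]=(M|G)/F$ is connected. -/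

import Mathlib

open scoped Matroid

universe u

namespace BergmanNested

section NestedSets

variable {L : Type u} [Lattice L] [BoundedOrder L]

/-- An element `X > ⊥` of a lattice is connected if its lower interval `[⊥, X]` is not isomorphic,
as a partially ordered set, to a product of two posets with more than one element each. -/
def IsConnectedElement (X : L) : Prop :=
  ⊥ < X ∧ ∀ (P Q : Type u) [PartialOrder P] [PartialOrder Q],
    Nonempty (Set.Iic X ≃o P × Q) → Subsingleton P ∨ Subsingleton Q

variable (L) in
/-- The minimal building set of a lattice: the set of its connected elements. -/
def minBuildingSet : Set L := {X | IsConnectedElement X}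

/-- `S` is nested with respect to `G`: it is a subset of `G`, and the join of any two or more
pairwise incomparable elements of `S` does not belong to `G`. -/
def IsNested (G S : Set L) : Prop :=
  S ⊆ G ∧ ∀ T : Finset L, (T : Set L) ⊆ S → IsAntichain (· ≤ ·) (T : Set L) →
    2 ≤ T.card → T.sup id ∉ G

/-- The nested set complex `N(L, G)` of a finite lattice `L`: the link of the top element in the
simplicial complex of all nested sets. -/
def nestedSetComplex (G : Set L) : Set (Set L) :=
  {S | ⊤ ∉ S ∧ IsNested G (insert ⊤ S)}

end NestedSets

section Flats

variable {α : Type u}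

/-- The flats of a matroid. -/
def Flats (M : Matroid α) : Type u := {F : Set α // M.IsFlat F}

theorem isFlat_inter {M : Matroid α} {F G : Set α} (hF : M.IsFlat F) (hG : M.IsFlat G) :
    M.IsFlat (F ∩ G) := by
  rw [Set.inter_eq_iInter]
  exact Matroid.IsFlat.iInter (fun b => by cases b <;> assumption)

/-- The lattice of flats, ordered by inclusion: the meet is the intersection, and the join is the
span of the union. -/
instance (M : Matroid α) : Lattice (Flats M) where
  le F G := F.1 ⊆ G.1
  le_refl F := Set.Subset.refl F.1
  le_trans F G H h₁ h₂ := Set.Subset.trans h₁ h₂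
  le_antisymm F G h₁ h₂ := Subtype.ext (Set.Subset.antisymm h₁ h₂)
  sup F G := ⟨M.closure (F.1 ∪ G.1), M.isFlat_closure _⟩
  le_sup_left F G := Set.subset_union_left.trans
    (M.subset_closure _ (Set.union_subset F.2.subset_ground G.2.subset_ground))
  le_sup_right F G := Set.subset_union_right.trans
    (M.subset_closure _ (Set.union_subset F.2.subset_ground G.2.subset_ground))
  sup_le F G H h₁ h₂ :=
    (M.closure_subset_closure (Set.union_subset h₁ h₂)).trans H.2.closure.subset
  inf F G := ⟨F.1 ∩ G.1, isFlat_inter F.2 G.2⟩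
  inf_le_left F G := Set.inter_subset_left
  inf_le_right F G := Set.inter_subset_right
  le_inf F G H h₁ h₂ := Set.subset_inter h₁ h₂

instance (M : Matroid α) : BoundedOrder (Flats M) where
  top := ⟨M.E, M.ground_isFlat⟩
  le_top F := F.2.subset_ground
  bot := ⟨M.closure ∅, M.isFlat_closure _⟩
  bot_le F := (M.closure_subset_closure (Set.empty_subset F.1)).trans F.2.closure.subset

/-- A matroid is connected if it has exactly one connected component: its ground set is nonempty,
and any two distinct elements lie in a common circuit. -/
def IsConnected (M : Matroid α) : Prop :=
  M.E.Nonempty ∧ ∀ e ∈ M.E, ∀ f ∈ M.E, e = f ∨ ∃ C, M.IsCircuit C ∧ e ∈ C ∧ f ∈ C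

/-- The matroid `M[F, G]` of an interval of flats: restrict to `G`, then contract `F`.
Its ground set is `G \ F`. -/
def interval (M : Matroid α) (F G : Set α) : Matroid α := (M ↾ G) ／ F

/-- The minimal nested set complex `N(M) = N(L_M, G_min)`, as an abstract simplicial complex on
the flats of `M`. -/
def minNestedSetComplex (M : Matroid α) : Set (Set (Flats M)) :=
  nestedSetComplex (minBuildingSet (Flats M))

end Flats

section Geometry

variable {α : Type u} [Fintype α]

variable (α) in
/-- The unit sphere in the hyperplane of vectors with coordinate sum zero. -/
def sphere : Set (α → ℝ) := {w | ∑ i, w i = 0 ∧ ∑ i, w i ^ 2 = 1}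

/-- The Bergman fan: on every circuit the minimum of `w` is attained at least twice. -/
def bergmanFan (M : Matroid α) : Set (α → ℝ) :=
  {w | ∀ C, M.IsCircuit C → ∃ i ∈ C, ∃ j ∈ C, i ≠ j ∧ ∀ k ∈ C, w i ≤ w k ∧ w j ≤ w k}

/-- The `w`-cost of a set. -/
noncomputable def cost (w : α → ℝ) (B : Set α) : ℝ := ∑ i, B.indicator w i

/-- The bases of the matroid `M_w`: the bases of `M` of maximal `w`-cost. -/
def maxBases (M : Matroid α) (w : α → ℝ) : Set (Set α) :=
  {B | M.IsBase B ∧ ∀ B', M.IsBase B' → cost w B' ≤ cost w B}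

/-- The closed cone of the normal fan of the matroid polytope that has `w` in its relative
interior: the closure of the set of all `w'` with `M_w' = M_w`. -/
def normalCone (M : Matroid α) (w : α → ℝ) : Set (α → ℝ) :=
  closure {w' | maxBases M w' = maxBases M w}

/-- The faces of the Bergman complex `B(M)`, a complex of spherical polytopes: the intersections
with the sphere of the cones of the normal fan of the matroid polytope that make up the
Bergman fan. -/
def bergmanComplex (M : Matroid α) : Set (Set (α → ℝ)) :=
  {Γ | ∃ w ∈ bergmanFan M, Γ = normalCone M w ∩ sphere α}

/-- The `0/1` incidence vector of a flat. -/
noncomputable def incidenceVector {M : Matroid α} (F : Flats M) : α → ℝ :=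
  F.1.indicator 1

/-- The spherical simplex of a set `S` of flats: the points of the sphere that are, up to
translation along the line of constant vectors, nonnegative combinations of the incidence vectors
of the members of `S`. -/
def sphericalSimplex {M : Matroid α} (S : Set (Flats M)) : Set (α → ℝ) :=
  {w ∈ sphere α | ∃ v ∈ PointedCone.hull ℝ (incidenceVector '' S), ∃ t : ℝ, w = v + fun _ => t}

/-- The faces of the geometric realization on the sphere of the minimal nested set complex. -/
def nestedSphericalComplex (M : Matroid α) : Set (Set (α → ℝ)) :=
  sphericalSimplex '' minNestedSetComplex M

end Geometry

end BergmanNested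

/-!
The cones of the Bergman fan and of the nested set fan are compared through superlevel sets. A
base of `M_w` is greedy, so it spans every superlevel set `{w ≥ t}`, hence every connected
component of one; `w` lies in the Bergman fan exactly when the sets `{w ≥ t}` are flats. Call
`levelComponents M w` the set of the components of these flats. Apart from the ground set they form
a nested set (`levelComponents_diff_top_mem`), and `w` is a nonnegative combination of their
incidence vectors up to a constant (`self_mem_nestedCone`). Since the bases of `M_w` span the
components, the cone of this nested set lies in the cone `Γ_w` of the normal fan
(`maxBases_subset_of_mem_nestedCone`), where `Γ_w` consists of the `w'` such that all bases of
`M_w` are bases of `M_w'` (`normalCone_eq`). Conversely each nested set is recovered as the set of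
level components of a positive combination of its members, because a union of an antichain in a
nested set is a flat with the members of the antichain as components
(`IsNested.component_biUnion`).

Suppose that `M[F, G]` is connected whenever `G` is. A connected flat `X` that is spanned by all
bases of `M_w` is then a component of a level set (`mem_levelComponents_of_spans`). To see this,
let `G` be the smallest level component that contains `X`, and let `F` be its part on the higher
levels. Exchanging elements of `G \ F` does not change the cost, so a base of `M_w` spans
`X ∪ F` and its complement in `G` separately, and the connectedness of `M[F, G]` gives
`X ∪ F = G`. Then `X` and `F` are a modular pair, and the connectedness of `M[X ∩ F, G]` gives
`F ⊆ X`. Both steps rest on `Spans.not_isCircuit_crossing`. If `w'` lies in `Γ_w`, the bases of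
`M_w` span the level components of `w'`, which are therefore level components of `w`. Hence `Γ_w`
is the cone of `levelComponents M w`.

If `M[F, G]` has a proper component `A` although `G` is connected, all bases of `M_w` for
`w = v_F + v_G` have the same number of elements in `A`, so that `Γ_w` contains `w ± c v_A` for
small `c`. If `Γ_w` were the cone of a nested set, the flats contributing to these two points would
contribute to `w`, hence be components of `F`, of `G` or of the ground set, and `v_A` would be
constant on `G \ F`.
-/

namespace BergmanNested

variable {α : Type u}

open Set

/-! ### Connected components of a matroid -/

/-- The connected component of `e` in `N`: the elements of the ground set that are equal to `e` or
lie in a common circuit with `e`. -/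
def component (N : Matroid α) (e : α) : Set α :=
  {f | f ∈ N.E ∧ (e = f ∨ ∃ C, N.IsCircuit C ∧ e ∈ C ∧ f ∈ C)}

theorem component_subset_ground (N : Matroid α) (e : α) : component N e ⊆ N.E := fun _ h => h.1

theorem component_restrict_subset (M : Matroid α) (X : Set α) (e : α) :
    component (M ↾ X) e ⊆ X := fun _ h => h.1

theorem mem_component_self {N : Matroid α} {e : α} (he : e ∈ N.E) : e ∈ component N e :=
  ⟨he, Or.inl rfl⟩

/-- Lying in a common circuit is a transitive relation. By induction on the size of the union of
two intersecting circuits: strong elimination replaces one of them, or both, in such a way that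
the union shrinks. -/
theorem exists_isCircuit_of_inter_nonempty [Finite α] {N : Matroid α} {e g : α} {C₁ C₂ : Set α}
    (h₁ : N.IsCircuit C₁) (h₂ : N.IsCircuit C₂) (he : e ∈ C₁) (hg : g ∈ C₂)
    (hne : (C₁ ∩ C₂).Nonempty) : ∃ C, N.IsCircuit C ∧ e ∈ C ∧ g ∈ C := by
  induction hn : (C₁ ∪ C₂).ncard using Nat.strong_induction_on generalizing C₁ C₂ with
  | _ n ih =>
  subst hn
  by_cases he2 : e ∈ C₂
  · exact ⟨C₂, h₂, he2, hg⟩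
  by_cases hg1 : g ∈ C₁
  · exact ⟨C₁, h₁, he, hg1⟩
  obtain ⟨x, hx1, hx2⟩ := hne
  obtain ⟨C₃, hC3s, hC3, heC3⟩ := h₁.strong_elimination h₂ hx1 hx2 he he2
  obtain ⟨C₄, hC4s, hC4, hgC4⟩ := h₂.strong_elimination h₁ hx2 hx1 hg hg1
  rw [union_comm C₂ C₁] at hC4s
  have hx3 : x ∉ C₃ := fun h => (hC3s h).2 rfl
  have hx4 : x ∉ C₄ := fun h => (hC4s h).2 rfl
  have h32 : (C₃ ∩ C₂).Nonempty := by
    by_contra hcon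
    have hsub : C₃ ⊆ C₁ := fun y hy => (hC3s hy).1.resolve_right fun h2 => hcon ⟨y, hy, h2⟩
    exact hx3 (hC3.eq_of_subset_isCircuit h₁ hsub ▸ hx1)
  by_cases hU : C₃ ∪ C₂ = C₁ ∪ C₂
  · obtain ⟨y, hy4, hy2⟩ : ∃ y ∈ C₄, y ∉ C₂ := by
      by_contra! hcon
      exact hx4 (hC4.eq_of_subset_isCircuit h₂ hcon ▸ hx2)
    have hy3 : y ∈ C₃ := by
      have : y ∈ C₃ ∪ C₂ := hU ▸ (hC4s hy4).1
      exact this.resolve_right hy2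
    refine ih _ (ncard_lt_ncard ?_) hC3 hC4 heC3 hgC4 ⟨y, hy3, hy4⟩ rfl
    refine ⟨union_subset (hC3s.trans sdiff_subset) (hC4s.trans sdiff_subset), fun hcon => ?_⟩
    exact (hcon (Or.inl hx1)).elim hx3 hx4
  · refine ih _ (ncard_lt_ncard (ssubset_of_subset_of_ne ?_ hU)) hC3 h₂ heC3 hg h32 rfl
    exact union_subset (hC3s.trans sdiff_subset) subset_union_right

theorem circuit_subset_component [Finite α] {N : Matroid α} {e f : α} {C : Set α}
    (hC : N.IsCircuit C) (hfC : f ∈ C) (hf : f ∈ component N e) : C ⊆ component N e := by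
  intro g hg
  refine ⟨hC.subset_ground hg, ?_⟩
  obtain ⟨-, rfl | ⟨D, hD, heD, hfD⟩⟩ := hf
  · exact Or.inr ⟨C, hC, hfC, hg⟩
  · exact Or.inr (exists_isCircuit_of_inter_nonempty hD hC heD hg ⟨f, hfD, hfC⟩)

theorem component_eq_of_mem [Finite α] {N : Matroid α} {e f : α}
    (hf : f ∈ component N e) : component N f = component N e := by
  obtain ⟨hfE, rfl | ⟨D, hD, heD, hfD⟩⟩ := id hf
  · rfl
  have key : ∀ a b, a ∈ D → b ∈ D → component N a ⊆ component N b := by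
    rintro a b ha hb g ⟨hg, rfl | ⟨C, hC, haC, hgC⟩⟩
    · exact ⟨hg, Or.inr ⟨D, hD, hb, ha⟩⟩
    · exact ⟨hg, Or.inr (exists_isCircuit_of_inter_nonempty hD hC hb hgC ⟨a, ha, haC⟩)⟩
  exact (key f e hfD heD).antisymm (key e f heD hfD)

/-- A set of elements is circuit-closed in `X` if it contains every circuit inside `X` that it
meets; these are the unions of connected components of the restriction to `X`. -/
def CircuitClosed (M : Matroid α) (X A : Set α) : Prop :=
  A ⊆ X ∧ ∀ C, M.IsCircuit C → C ⊆ X → (C ∩ A).Nonempty → C ⊆ A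

theorem circuitClosed_component [Finite α] {M : Matroid α} {X : Set α} (hX : X ⊆ M.E) (e : α) :
    CircuitClosed M X (component (M ↾ X) e) := by
  refine ⟨component_restrict_subset M X e, fun C hC hCX ⟨f, hfC, hf⟩ => ?_⟩
  exact circuit_subset_component ((Matroid.restrict_isCircuit_iff hX).2 ⟨hC, hCX⟩) hfC hf

theorem CircuitClosed.diff {M : Matroid α} {X A : Set α} (h : CircuitClosed M X A) :
    CircuitClosed M X (X \ A) := by
  refine ⟨sdiff_subset, fun C hC hCX ⟨f, hfC, hf⟩ g hg => ⟨hCX hg, fun hgA => ?_⟩⟩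
  exact hf.2 (h.2 C hC hCX ⟨g, hg, hgA⟩ hfC)

theorem CircuitClosed.mem_closure_inter {M : Matroid α} {X A D : Set α} {e : α}
    (h : CircuitClosed M X A) (hX : X ⊆ M.E) (hD : D ⊆ X) (he : e ∈ A) (heD : e ∈ M.closure D) :
    e ∈ M.closure (D ∩ A) := by
  by_cases heD' : e ∈ D
  · exact M.subset_closure (D ∩ A) (inter_subset_left.trans (hD.trans hX)) ⟨heD', he⟩
  obtain ⟨C, hCD, hC, heC⟩ := (Matroid.mem_closure_iff_exists_isCircuit heD').1 heD
  have hCX : C ⊆ X := hCD.trans (insert_subset (h.1 he) hD)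
  have hCA := h.2 C hC hCX ⟨e, heC, he⟩
  rw [Matroid.mem_closure_iff_exists_isCircuit fun h => heD' h.1]
  refine ⟨C, fun g hg => ?_, hC, heC⟩
  exact (hCD hg).imp id fun hgD => ⟨hgD, hCA hg⟩

/-- In a loopless matroid the union of a flat inside `A` and a flat inside `X \ A` is a flat, if
`X` is a flat and no circuit inside `X` crosses `A`. -/
theorem CircuitClosed.isFlat_union {M : Matroid α} [M.Loopless] {X A Y Z : Set α}
    (h : CircuitClosed M X A) (hX : M.IsFlat X) (hY : M.IsFlat Y) (hZ : M.IsFlat Z) (hYA : Y ⊆ A)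
    (hZA : Z ⊆ X \ A) : M.IsFlat (Y ∪ Z) := by
  have hYZX : Y ∪ Z ⊆ X := union_subset (hYA.trans h.1) (hZA.trans sdiff_subset)
  rw [Matroid.isFlat_iff_closure_eq]
  refine Set.Subset.antisymm (fun e he => ?_) (M.subset_closure _ (hYZX.trans hX.subset_ground))
  have heX : e ∈ X := hX.closure ▸ M.closure_subset_closure hYZX he
  by_cases heA : e ∈ A
  · have := h.mem_closure_inter hX.subset_ground hYZX heA he
    refine Or.inl (hY.closure ▸ M.closure_subset_closure ?_ this)
    rintro g ⟨hg | hg, hgA⟩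
    exacts [hg, ((hZA hg).2 hgA).elim]
  · have := h.diff.mem_closure_inter hX.subset_ground hYZX ⟨heX, heA⟩ he
    refine Or.inr (hZ.closure ▸ M.closure_subset_closure ?_ this)
    rintro g ⟨hg | hg, hgA⟩
    exacts [(hgA.2 (hYA hg)).elim, hg]

theorem isFlat_empty (M : Matroid α) [M.Loopless] : M.IsFlat ∅ := by
  rw [Matroid.isFlat_iff_closure_eq]
  exact M.loops_eq_empty

theorem CircuitClosed.isFlat {M : Matroid α} [M.Loopless] {X A : Set α}
    (h : CircuitClosed M X A) (hX : M.IsFlat X) : M.IsFlat A := by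
  rw [Matroid.isFlat_iff_closure_eq]
  refine Set.Subset.antisymm (fun e he => ?_) (M.subset_closure _ (h.1.trans hX.subset_ground))
  have heX : e ∈ X := hX.closure ▸ M.closure_subset_closure h.1 he
  by_contra heA
  have := h.diff.mem_closure_inter hX.subset_ground h.1 ⟨heX, heA⟩ he
  rw [inter_sdiff_self] at this
  exact (M.loops_eq_empty ▸ this : e ∈ (∅ : Set α))

theorem isFlat_component [Finite α] {M : Matroid α} [M.Loopless] {X : Set α} (hX : M.IsFlat X)
    (e : α) : M.IsFlat (component (M ↾ X) e) :=
  (circuitClosed_component hX.subset_ground e).isFlat hX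

theorem isConnected_component [Finite α] {M : Matroid α} {X : Set α} (hX : X ⊆ M.E) {e : α}
    (he : e ∈ X) : IsConnected (M ↾ component (M ↾ X) e) := by
  refine ⟨⟨e, mem_component_self (N := M ↾ X) he⟩, fun f hf g hg => ?_⟩
  have hg' : g ∈ component (M ↾ X) f := (component_eq_of_mem (N := M ↾ X) hf).symm ▸ hg
  refine hg'.2.imp id ?_
  rintro ⟨C, hC, hfC, hgC⟩
  have hC' := (Matroid.restrict_isCircuit_iff hX).1 hC
  refine ⟨C, (Matroid.restrict_isCircuit_iff ((component_restrict_subset M X e).trans hX)).2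
    ⟨hC'.1, ?_⟩, hfC, hgC⟩
  exact circuit_subset_component hC hfC hf

/-- Components are the maximal connected subsets. -/
theorem subset_component [Finite α] {M : Matroid α} {X Y : Set α} (hX : X ⊆ M.E)
    (hYX : Y ⊆ X) (hY : IsConnected (M ↾ Y)) {e f : α} (hfY : f ∈ Y)
    (hf : f ∈ component (M ↾ X) e) : Y ⊆ component (M ↾ X) e := by
  intro g hg
  rw [← component_eq_of_mem (N := M ↾ X) hf]
  refine ⟨hYX hg, (hY.2 f hfY g hg).imp id ?_⟩
  rintro ⟨C, hC, hfC, hgC⟩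
  have hC' := (Matroid.restrict_isCircuit_iff (hYX.trans hX)).1 hC
  exact ⟨C, (Matroid.restrict_isCircuit_iff hX).2 ⟨hC'.1, hC'.2.trans hYX⟩, hfC, hgC⟩

theorem component_eq_self [Finite α] {M : Matroid α} {X : Set α} (hX : X ⊆ M.E)
    (hc : IsConnected (M ↾ X)) {e : α} (he : e ∈ X) : component (M ↾ X) e = X :=
  (component_restrict_subset M X e).antisymm
    (subset_component hX Subset.rfl hc he (mem_component_self (N := M ↾ X) he))

/-! ### Sets spanned by an independent set -/

/-- The set `X` is spanned by those elements of `B` that lie in `X`. If `B` is independent, this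
says that `B ∩ X` is a basis of `X`. -/
def Spans (M : Matroid α) (B X : Set α) : Prop := X ⊆ M.closure (B ∩ X)

theorem Spans.isBasis {M : Matroid α} {B X : Set α} (h : Spans M B X) (hB : M.Indep B) :
    M.IsBasis (B ∩ X) X :=
  (hB.subset inter_subset_left).isBasis_of_subset_of_subset_closure inter_subset_right h

theorem Spans.union {M : Matroid α} {B X Y : Set α} (hX : Spans M B X) (hY : Spans M B Y) :
    Spans M B (X ∪ Y) :=
  union_subset (hX.trans (M.closure_subset_closure (inter_subset_inter_right _ subset_union_left)))
    (hY.trans (M.closure_subset_closure (inter_subset_inter_right _ subset_union_right)))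

theorem Spans.inter {M : Matroid α} {B X Y : Set α} (hX : Spans M B X) (hY : Spans M B Y)
    (hB : M.Indep B) : Spans M B (X ∩ Y) := by
  intro e he
  have h : M.Indep (B ∩ X ∪ B ∩ Y) := hB.subset (union_subset inter_subset_left inter_subset_left)
  have := h.closure_inter_eq_inter_closure
  rw [inter_inter_distrib_left, this]
  exact ⟨hX he.1, hY he.2⟩

theorem Spans.circuitClosed {M : Matroid α} {B X A : Set α} (h : Spans M B X) (hX : X ⊆ M.E)
    (hA : CircuitClosed M X A) : Spans M B A := by
  intro e he
  have := hA.mem_closure_inter hX inter_subset_right he (h (hA.1 he))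
  rwa [inter_assoc, inter_eq_self_of_subset_right hA.1] at this

theorem Spans.ncard_inter_le [Finite α] {M : Matroid α} {B I X : Set α} (h : Spans M B X)
    (hB : M.Indep B) (hI : M.Indep I) : (I ∩ X).ncard ≤ (B ∩ X).ncard := by
  have h1 := (hI.subset (inter_subset_left (t := X))).encard_le_eRk_of_subset inter_subset_right
  rw [← (h.isBasis hB).encard_eq_eRk, ← (toFinite _).cast_ncard_eq,
    ← (toFinite _).cast_ncard_eq] at h1
  exact_mod_cast h1

/-- An independent set `B` that spans `X` and `Y` makes them a modular pair, so that the
contraction of `X ∩ Y` in the restriction to `X ∪ Y` is the direct sum of its restrictions to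
`X \ Y` and `Y \ X`: no circuit crosses. -/
theorem Spans.not_isCircuit_crossing [Finite α] {M : Matroid α} {B X Y C : Set α}
    (hB : M.Indep B) (hX : Spans M B X) (hY : Spans M B Y) (hXE : X ⊆ M.E) (hYE : Y ⊆ M.E)
    (hC : (interval M (X ∩ Y) (X ∪ Y)).IsCircuit C)
    {e f : α} (heC : e ∈ C) (heY : e ∉ Y) (hfC : f ∈ C) (hfX : f ∉ X) :
    False := by
  have hG : X ∪ Y ⊆ M.E := union_subset hXE hYE
  have hZ := hX.inter hY hB
  have hZb : (M ↾ (X ∪ Y)).IsBasis (B ∩ (X ∩ Y)) (X ∩ Y) := by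
    rw [Matroid.isBasis_restrict_iff hG]
    exact ⟨hZ.isBasis hB, inter_subset_left.trans subset_union_left⟩
  have hind : ∀ J, (interval M (X ∩ Y) (X ∪ Y)).Indep J ↔
      (M ↾ (X ∪ Y)).Indep (J ∪ B ∩ (X ∩ Y)) ∧ Disjoint (X ∩ Y) J :=
    fun J => hZb.contract_indep_iff
  have hCE : C ⊆ (X ∪ Y) \ (X ∩ Y) := hC.subset_ground
  have hCX := ((hind _).1 (hC.ssubset_indep (X := C ∩ X)
    ⟨inter_subset_left, fun h => hfX (h hfC).2⟩)).1.of_restrict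
  have hCY := ((hind _).1 (hC.ssubset_indep (X := C ∩ Y)
    ⟨inter_subset_left, fun h => heY (h heC).2⟩)).1.of_restrict
  obtain ⟨I, hI, hIs⟩ := hCX.subset_isBasis_of_subset
    (union_subset inter_subset_right (inter_subset_right.trans inter_subset_left)) hXE
  obtain ⟨J, hJ, hJs⟩ := hCY.subset_isBasis_of_subset
    (union_subset inter_subset_right (inter_subset_right.trans inter_subset_right)) hYE
  have hcl : M.closure (I ∪ J) = M.closure (X ∪ Y) :=
    by rw [← M.closure_union_closure_left_eq, ← M.closure_union_closure_right_eq,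
      hI.closure_eq_closure, hJ.closure_eq_closure, M.closure_union_closure_right_eq,
      M.closure_union_closure_left_eq]
  have hIJ : M.Indep (I ∪ J) := by
    refine Matroid.IsRkFinite.indep_of_encard_le_eRk (M.isRkFinite_of_finite (toFinite _)) ?_
    rw [← Matroid.eRk_closure_eq, hcl, Matroid.eRk_closure_eq,
      ← ((hX.union hY).isBasis hB).encard_eq_eRk]
    have h1 := encard_union_add_encard_inter I J
    have h2 := encard_union_add_encard_inter (B ∩ X) (B ∩ Y)
    rw [hI.encard_eq_eRk, hJ.encard_eq_eRk, ← (hX.isBasis hB).encard_eq_eRk,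
      ← (hY.isBasis hB).encard_eq_eRk, ← h2, ← inter_union_distrib_left,
      ← inter_inter_distrib_left] at h1
    have h3 : (B ∩ (X ∩ Y)).encard ≤ (I ∩ J).encard :=
      encard_le_encard (subset_inter (subset_union_right.trans hIs) (subset_union_right.trans hJs))
    simp only [← (toFinite _).cast_ncard_eq] at h1 h3 ⊢
    norm_cast at h1 h3 ⊢
    omega
  refine hC.not_indep ((hind C).2 ⟨?_, disjoint_left.2 fun x hx hxC => (hCE hxC).2 hx⟩)
  rw [Matroid.restrict_indep_iff]
  refine ⟨hIJ.subset (union_subset (fun x hx => ?_) ?_), union_subset (hCE.trans sdiff_subset)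
    (inter_subset_right.trans (inter_subset_left.trans subset_union_left))⟩
  · exact (hCE hx).1.imp (fun h => hIs (Or.inl ⟨hx, h⟩)) fun h => hJs (Or.inl ⟨hx, h⟩)
  · exact (subset_union_right.trans hIs).trans subset_union_left

/-! ### Connected elements of the lattice of flats -/

instance [Finite α] (M : Matroid α) : Finite (Flats M) := Subtype.finite

theorem bot_val (M : Matroid α) [M.Loopless] : (⊥ : Flats M).1 = ∅ := M.loops_eq_empty

theorem bot_lt_iff_nonempty {M : Matroid α} [M.Loopless] {X : Flats M} : ⊥ < X ↔ X.1.Nonempty := by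
  rw [bot_lt_iff_ne_bot, nonempty_iff_ne_empty, not_iff_not]
  exact ⟨fun h => h ▸ bot_val M, fun h => Subtype.ext (h.trans (bot_val M).symm)⟩

/-- A product decomposition of the lower interval of a flat `X` partitions `X` into two parts that
no circuit crosses. -/
theorem isConnectedElement_of_isConnected {M : Matroid α} [M.Loopless] {X : Flats M}
    (hc : IsConnected (M ↾ X.1)) : IsConnectedElement X := by
  refine ⟨bot_lt_iff_nonempty.2 hc.1, fun P Q _ _ ⟨φ⟩ => ?_⟩
  by_contra! hcon
  obtain ⟨hP, hQ⟩ := hcon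
  let b : Set.Iic X := ⟨⊥, mem_Iic.2 bot_le⟩
  let t : Set.Iic X := ⟨X, mem_Iic.2 le_rfl⟩
  have hb : ∀ z : P × Q, φ b ≤ z := fun z => φ.le_symm_apply.1 (bot_le (α := Flats M))
  have ht : ∀ z : P × Q, z ≤ φ t := fun z => φ.symm_apply_le.1 (φ.symm z).2
  let x := φ.symm ((φ t).1, (φ b).2)
  let y := φ.symm ((φ b).1, (φ t).2)
  have hP0 : ∀ p, (φ b).1 ≤ p := fun p => (hb (p, (φ b).2)).1
  have hQ0 : ∀ q, (φ b).2 ≤ q := fun q => (hb ((φ b).1, q)).2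
  have hP1 : ∀ p, p ≤ (φ t).1 := fun p => (ht (p, (φ b).2)).1
  have hQ1 : ∀ q, q ≤ (φ t).2 := fun q => (ht ((φ b).1, q)).2
  -- the rank one flat through an element of `X`
  let c : ∀ e : X.1, Set.Iic X := fun e => ⟨⟨M.closure {e.1}, M.isFlat_closure _⟩,
    (M.closure_subset_closure (singleton_subset_iff.2 e.2)).trans X.2.closure.subset⟩
  have hc_le : ∀ (e : X.1) (Y : Set.Iic X), c e ≤ Y ↔ e.1 ∈ Y.1.1 := fun e Y => by
    refine ⟨fun h => h (M.mem_closure_of_mem' rfl (X.2.subset_ground e.2)), fun h => ?_⟩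
    exact (M.closure_subset_closure (singleton_subset_iff.2 h)).trans Y.1.2.closure.subset
  have hne_bot : ∀ Y : Set.Iic X, Y ≠ b → Y.1.1.Nonempty := fun Y hY => by
    refine bot_lt_iff_nonempty.1 (bot_lt_iff_ne_bot.2 fun h => hY (Subtype.ext h))
  have hxne : x.1.1.Nonempty := hne_bot x fun h => not_subsingleton P ⟨fun p q => by
    have h1 : (φ t).1 = (φ b).1 := by rw [← h]; simp [x]
    exact ((hP1 p).trans (h1.le.trans (hP0 q))).antisymm ((hP1 q).trans (h1.le.trans (hP0 p)))⟩
  have hyne : y.1.1.Nonempty := hne_bot y fun h => not_subsingleton Q ⟨fun p q => by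
    have h1 : (φ t).2 = (φ b).2 := by rw [← h]; simp [y]
    exact ((hQ1 p).trans (h1.le.trans (hQ0 q))).antisymm ((hQ1 q).trans (h1.le.trans (hQ0 p)))⟩
  have hdisj : ∀ e, e ∈ x.1.1 → e ∈ y.1.1 → False := fun e hex hey => by
    have heX : e ∈ X.1 := x.2 hex
    have h1 := φ.le_symm_apply.1 ((hc_le ⟨e, heX⟩ x).2 hex)
    have h2 := φ.le_symm_apply.1 ((hc_le ⟨e, heX⟩ y).2 hey)
    have h3 : c ⟨e, heX⟩ ≤ b := φ.le_iff_le.1 ⟨h2.1, h1.2⟩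
    have h4 : e ∈ (⊥ : Flats M).1 := (hc_le ⟨e, heX⟩ b).1 h3
    rw [bot_val] at h4
    exact h4
  have hcover : ∀ e ∈ X.1, e ∉ x.1.1 → e ∈ y.1.1 := fun e heX hex => by
    let a := φ.symm ((φ (c ⟨e, heX⟩)).1, (φ b).2)
    have hac : a ≤ c ⟨e, heX⟩ := φ.symm_apply_le.2 ⟨le_rfl, hQ0 _⟩
    have hax : a ≤ x := φ.symm.le_iff_le.2 ⟨hP1 _, le_rfl⟩
    by_cases hab : a = b
    · refine (hc_le ⟨e, heX⟩ y).1 (φ.le_symm_apply.2 ⟨?_, hQ1 _⟩)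
      have : (φ a).1 = (φ (c ⟨e, heX⟩)).1 := by simp [a]
      rw [← this, hab]
    · obtain ⟨g, hg⟩ := hne_bot a hab
      have hge : g ∈ M.closure {e} := hac hg
      have heg : e ∈ M.closure {g} :=
        ((M.isNonloop_of_loopless (X.2.subset_ground (a.2 hg))).mem_closure_comm
          (M.isNonloop_of_loopless (X.2.subset_ground heX))).2 hge
      refine (hex (hax ?_)).elim
      exact (M.closure_subset_closure (singleton_subset_iff.2 hg)).trans a.1.2.closure.subset heg
  obtain ⟨e, hex⟩ := hxne
  obtain ⟨f, hfy⟩ := hyne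
  have heX : e ∈ X.1 := x.2 hex
  obtain rfl | ⟨C, hC, heC, hfC⟩ := hc.2 e heX f (y.2 hfy)
  · exact hdisj e hex hfy
  obtain ⟨hC, hCX⟩ := (Matroid.restrict_isCircuit_iff X.2.subset_ground).1 hC
  have hcl : ∀ (D : Set α) (Y : Flats M), D ⊆ Y.1 → M.closure D ⊆ Y.1 := fun D Y h =>
    (M.closure_subset_closure h).trans Y.2.closure.subset
  let z₁ : Set.Iic X := ⟨⟨M.closure ((C ∩ x.1.1) \ {e}), M.isFlat_closure _⟩,
    hcl _ _ ((sdiff_subset.trans inter_subset_left).trans hCX)⟩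
  let z₂ : Set.Iic X := ⟨⟨M.closure (C ∩ y.1.1), M.isFlat_closure _⟩,
    hcl _ _ (inter_subset_left.trans hCX)⟩
  have hz₁x : z₁ ≤ x := hcl _ _ (sdiff_subset.trans inter_subset_right)
  have hz₂y : z₂ ≤ y := hcl _ _ inter_subset_right
  let W := φ.symm ((φ z₁).1, (φ z₂).2)
  have hz₁W : z₁ ≤ W :=
    φ.le_symm_apply.2 ⟨le_rfl, ((φ.le_symm_apply.1 hz₁x).2).trans (hQ0 _)⟩
  have hz₂W : z₂ ≤ W :=
    φ.le_symm_apply.2 ⟨((φ.le_symm_apply.1 hz₂y).1).trans (hP0 _), le_rfl⟩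
  have hCW : C \ {e} ⊆ W.1.1 := fun g hg => by
    by_cases hgx : g ∈ x.1.1
    · exact hz₁W (M.subset_closure _ (fun a h => hC.subset_ground h.1.1) ⟨⟨hg.1, hgx⟩, hg.2⟩)
    · exact hz₂W (M.subset_closure _ (fun a h => hC.subset_ground h.1)
        ⟨hg.1, hcover g (hCX hg.1) hgx⟩)
  have heW : e ∈ W.1.1 := hcl _ _ hCW (hC.mem_closure_sdiff_singleton_of_mem heC)
  have h1 := φ.le_symm_apply.1 ((hc_le ⟨e, heX⟩ W).2 heW)
  have h2 := φ.le_symm_apply.1 ((hc_le ⟨e, heX⟩ x).2 hex)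
  have h3 : c ⟨e, heX⟩ ≤ z₁ := φ.le_iff_le.1 ⟨h1.1, h2.2.trans (hQ0 _)⟩
  have h4 : e ∈ M.closure ((C ∩ x.1.1) \ {e}) := (hc_le ⟨e, heX⟩ z₁).1 h3
  have hef : e ≠ f := fun h => hdisj e hex (h ▸ hfy)
  refine (hC.sdiff_singleton_indep hfC).notMem_closure_sdiff_of_mem ⟨heC, hef⟩
    (M.closure_subset_closure ?_ h4)
  rintro g ⟨⟨hgC, hgx⟩, hge⟩
  exact ⟨⟨hgC, fun h => hdisj g hgx (h ▸ hfy)⟩, hge⟩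

/-- If no circuit crosses the subset `A` of the flat `X`, then the lower interval of `X` is the
product of the lower intervals of `A` and `X \ A`. -/
def CircuitClosed.orderIso {M : Matroid α} [M.Loopless] {X a b : Flats M}
    (h : CircuitClosed M X.1 a.1) (hb : b.1 = X.1 \ a.1) :
    Set.Iic X ≃o Set.Iic a × Set.Iic b where
  toFun Z := (⟨Z.1 ⊓ a, mem_Iic.2 inf_le_right⟩, ⟨Z.1 ⊓ b, mem_Iic.2 inf_le_right⟩)
  invFun p := ⟨⟨p.1.1.1 ∪ p.2.1.1,
    h.isFlat_union X.2 p.1.1.2 p.2.1.2 p.1.2 (subset_trans (a := p.2.1.1) p.2.2 hb.subset)⟩,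
    union_subset (subset_trans (a := p.1.1.1) p.1.2 h.1)
      (subset_trans (a := p.2.1.1) p.2.2 (hb.subset.trans sdiff_subset))⟩
  left_inv Z := by
    apply Subtype.ext; apply Subtype.ext
    change Z.1.1 ∩ a.1 ∪ Z.1.1 ∩ b.1 = Z.1.1
    rw [← inter_union_distrib_left, hb, union_sdiff_cancel h.1]
    exact inter_eq_self_of_subset_left Z.2
  right_inv p := by
    have h1 : p.1.1.1 ⊆ a.1 := p.1.2
    have h2 : p.2.1.1 ⊆ b.1 := p.2.2
    have h3 : Disjoint a.1 b.1 := hb ▸ disjoint_sdiff_right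
    refine Prod.ext (Subtype.ext (Subtype.ext ?_)) (Subtype.ext (Subtype.ext ?_))
    · change (p.1.1.1 ∪ p.2.1.1) ∩ a.1 = p.1.1.1
      rw [union_inter_distrib_right, inter_eq_self_of_subset_left h1,
        (h3.symm.mono_left h2).inter_eq, union_empty]
    · change (p.1.1.1 ∪ p.2.1.1) ∩ b.1 = p.2.1.1
      rw [union_inter_distrib_right, inter_eq_self_of_subset_left h2,
        (h3.mono_left h1).inter_eq, empty_union]
  map_rel_iff' {Z Z'} := by
    change (Z.1.1 ∩ a.1 ⊆ Z'.1.1 ∩ a.1 ∧ Z.1.1 ∩ b.1 ⊆ Z'.1.1 ∩ b.1) ↔ Z.1.1 ⊆ Z'.1.1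
    refine ⟨fun ⟨h1, h2⟩ e he => ?_, fun h => ⟨inter_subset_inter_left _ h,
      inter_subset_inter_left _ h⟩⟩
    by_cases hea : e ∈ a.1
    · exact (h1 ⟨he, hea⟩).1
    · exact (h2 ⟨he, hb.symm ▸ ⟨Z.2 he, hea⟩⟩).1

theorem isConnectedElement_iff [Finite α] {M : Matroid α} [M.Loopless] {X : Flats M} :
    IsConnectedElement X ↔ IsConnected (M ↾ X.1) := by
  refine ⟨fun h => ⟨bot_lt_iff_nonempty.1 h.1, fun e he f hf => ?_⟩,
    isConnectedElement_of_isConnected⟩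
  by_contra hcon
  have hcc := circuitClosed_component X.2.subset_ground e
  let a : Flats M := ⟨component (M ↾ X.1) e, isFlat_component X.2 e⟩
  let b : Flats M := ⟨X.1 \ a.1, hcc.diff.isFlat X.2⟩
  have hea : e ∈ a.1 := mem_component_self (N := M ↾ X.1) he
  have hfb : f ∈ b.1 := ⟨hf, fun h => hcon h.2⟩
  have key : ∀ (Y : Flats M) (g : α), g ∈ Y.1 → ¬ Subsingleton (Set.Iic Y) := fun Y g hg hs => by
    have : (⟨⊥, mem_Iic.2 bot_le⟩ : Set.Iic Y) = ⟨Y, mem_Iic.2 le_rfl⟩ := Subsingleton.elim _ _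
    have h2 : ⊥ = Y := congrArg Subtype.val this
    rw [← h2, bot_val] at hg
    exact hg
  exact (h.2 _ _ ⟨hcc.orderIso (a := a) (b := b) rfl⟩).elim (key a e hea) (key b f hfb)

/-! ### Nested sets of connected flats -/

theorem sup_val {M : Matroid α} (T : Finset (Flats M)) :
    (T.sup id).1 = M.closure (⋃ X ∈ T, X.1) := by
  refine Set.Subset.antisymm ?_ ?_
  · have : T.sup id ≤ ⟨M.closure (⋃ X ∈ T, X.1), M.isFlat_closure _⟩ := Finset.sup_le fun X hX =>
      (subset_biUnion_of_mem (u := fun X : Flats M => X.1) hX).trans (M.subset_closure _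
        (iUnion₂_subset fun Y _ => Y.2.subset_ground))
    exact this
  · rw [← (T.sup id).2.closure]
    exact M.closure_subset_closure (iUnion₂_subset fun X hX =>
      show X ≤ T.sup id from Finset.le_sup (f := id) hX)

/-- The union of an antichain in a nested set is a flat, and its connected components are the
members of the antichain. Indeed each component of the span of the union is the join of the
members below it, so that there is exactly one such member. -/
theorem IsNested.component_biUnion [Finite α] {M : Matroid α} [M.Loopless] {S : Set (Flats M)}
    (hS : IsNested (minBuildingSet (Flats M)) S) {T : Finset (Flats M)} (hTS : (T : Set _) ⊆ S)
    (hT : IsAntichain (· ≤ ·) (T : Set (Flats M))) :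
    M.IsFlat (⋃ X ∈ T, X.1) ∧
      ∀ X ∈ T, ∀ e ∈ X.1, component (M ↾ ⋃ X ∈ T, X.1) e = X.1 := by
  classical
  set U := ⋃ X ∈ T, X.1 with hU
  have hUE : U ⊆ M.E := iUnion₂_subset fun Y _ => Y.2.subset_ground
  have hconn : ∀ X ∈ T, IsConnected (M ↾ X.1) := fun X hX =>
    isConnectedElement_iff.1 (hS.1 (hTS hX))
  have hJ := M.isFlat_closure U
  set J := M.closure U
  have hUJ : U ⊆ J := M.subset_closure U hUE
  have hXU : ∀ X ∈ T, X.1 ⊆ U := fun X hX => subset_biUnion_of_mem (u := fun X : Flats M => X.1) hX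
  have key : ∀ e ∈ J, ∃ X ∈ T, component (M ↾ J) e = X.1 := by
    intro e he
    have heZ : e ∈ component (M ↾ J) e := mem_component_self (N := M ↾ J) he
    have hcc := circuitClosed_component hJ.subset_ground e
    have hZ := isConnected_component hJ.subset_ground he
    let Z : Flats M := ⟨component (M ↾ J) e, isFlat_component hJ e⟩
    let TZ := T.filter fun X => X ≤ Z
    have hsup : TZ.sup id = Z := by
      refine le_antisymm (Finset.sup_le fun X hX => (Finset.mem_filter.1 hX).2) fun f hf => ?_
      rw [sup_val]
      have hf' := hcc.mem_closure_inter hJ.subset_ground hUJ hf (hcc.1 hf)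
      refine M.closure_subset_closure ?_ hf'
      rintro g ⟨hgU, hgZ⟩
      obtain ⟨X, hX, hgX⟩ := mem_iUnion₂.1 hgU
      refine mem_iUnion₂.2 ⟨X, Finset.mem_filter.2 ⟨hX, ?_⟩, hgX⟩
      exact subset_component hJ.subset_ground ((hXU X hX).trans hUJ) (hconn X hX) hgX hgZ
    have hcard : TZ.card < 2 := by
      by_contra! h2
      refine hS.2 TZ (fun X hX => hTS (Finset.mem_filter.1 hX).1)
        (hT.subset fun X hX => (Finset.mem_filter.1 hX).1) h2 ?_
      rw [hsup]
      exact isConnectedElement_iff.2 hZ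
    obtain h0 | h1 : TZ.card = 0 ∨ TZ.card = 1 := by omega
    · rw [Finset.card_eq_zero.1 h0, Finset.sup_empty] at hsup
      have : e ∈ (⊥ : Flats M).1 := hsup ▸ heZ
      rw [bot_val] at this
      exact this.elim
    · obtain ⟨X, hX⟩ := Finset.card_eq_one.1 h1
      rw [hX, Finset.sup_singleton] at hsup
      have : X ∈ TZ := hX ▸ Finset.mem_singleton_self X
      exact ⟨X, (Finset.mem_filter.1 this).1, (congrArg Subtype.val hsup).symm⟩
  have hJU : J = U := by
    refine Set.Subset.antisymm (fun e he => ?_) hUJ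
    obtain ⟨X, hX, h⟩ := key e he
    exact hXU X hX (h ▸ mem_component_self (N := M ↾ J) he)
  rw [hJU] at key hJ
  refine ⟨hJ, fun X hX e he => ?_⟩
  obtain ⟨Y, hY, h⟩ := key e (hXU X hX he)
  have heY := mem_component_self (N := M ↾ U) (hXU X hX he)
  have hXY : X ≤ Y :=
    (subset_component hUE (hXU X hX) (hconn X hX) he heY).trans h.subset
  rw [h, hT.eq hX hY hXY]

/-- Intersecting members of a nested set are comparable. -/
theorem IsNested.le_or_le [Finite α] {M : Matroid α} [M.Loopless] {S : Set (Flats M)}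
    (hS : IsNested (minBuildingSet (Flats M)) S) {X Y : Flats M} (hX : X ∈ S) (hY : Y ∈ S) {e : α}
    (heX : e ∈ X.1) (heY : e ∈ Y.1) : X ≤ Y ∨ Y ≤ X := by
  classical
  by_contra! hcon
  have hT : IsAntichain (· ≤ ·) (({X, Y} : Finset (Flats M)) : Set (Flats M)) := by
    rw [Finset.coe_pair]
    rintro A (rfl | rfl) B (rfl | rfl) hne
    exacts [(hne rfl).elim, hcon.1, hcon.2, (hne rfl).elim]
  have h := (hS.component_biUnion (T := {X, Y}) (by
    rw [Finset.coe_pair]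
    rintro A (rfl | rfl) <;> assumption) hT).2
  have h1 := h X (by simp) e heX
  have h2 := h Y (by simp) e heY
  exact hcon.1 (h1.symm.trans h2).subset

theorem IsNested.mono {L : Type u} [Lattice L] [BoundedOrder L] {G S S' : Set L}
    (h : IsNested G S) (hS : S' ⊆ S) : IsNested G S' :=
  ⟨hS.trans h.1, fun T hT => h.2 T (hT.trans hS)⟩

/-! ### Bases of maximal cost -/

section Cost

variable {M : Matroid α} {w : α → ℝ}

theorem exchange_isBase {B : Set α} (hB : M.IsBase B) {e f : α} (heE : e ∈ M.E) (he : e ∉ B)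
    (hf : f ∈ M.fundCircuit e B) (hef : f ≠ e) : f ∈ B ∧ M.IsBase (insert e B \ {f}) := by
  have hfB : f ∈ B := (M.fundCircuit_subset_insert e B hf).resolve_left hef
  refine ⟨hfB, hB.exchange_isBase_of_indep' hfB he ?_⟩
  exact (hB.indep.mem_fundCircuit_iff (hB.closure_eq.symm ▸ heE) he).1 hf

theorem isFlat_of_mem_bergmanFan {U : Set α} (hw : w ∈ bergmanFan M) (hU : U ⊆ M.E)
    (hup : ∀ e ∈ U, ∀ f ∉ U, w f < w e) : M.IsFlat U := by
  rw [Matroid.isFlat_iff_closure_eq]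
  refine Set.Subset.antisymm (fun e he => ?_) (M.subset_closure _ hU)
  by_contra heU
  obtain ⟨C, hCU, hC, heC⟩ := (Matroid.mem_closure_iff_exists_isCircuit heU).1 he
  obtain ⟨i, hi, j, hj, hij, hmin⟩ := hw C hC
  obtain ⟨k, hkC, hke, hk⟩ : ∃ k ∈ C, k ≠ e ∧ w k ≤ w e := by
    by_cases h : i = e
    · exact ⟨j, hj, fun h' => hij (h.trans h'.symm), (hmin e heC).2⟩
    · exact ⟨i, hi, h, (hmin e heC).1⟩
  exact (hup k ((hCU hkC).resolve_left hke) e heU).not_ge hk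

theorem isFlat_level (hE : M.E = univ) (hw : w ∈ bergmanFan M) (t : ℝ) :
    M.IsFlat {e | t ≤ w e} :=
  isFlat_of_mem_bergmanFan hw (hE ▸ subset_univ _) fun _ he _ hf =>
    (not_le.1 hf).trans_le he

variable [Fintype α]

theorem cost_add (v w : α → ℝ) (B : Set α) : cost (v + w) B = cost v B + cost w B := by
  simp [cost, Set.indicator_add', Finset.sum_add_distrib]

theorem cost_smul (c : ℝ) (w : α → ℝ) (B : Set α) : cost (c • w) B = c * cost w B := by
  rw [cost, cost, Finset.mul_sum]
  refine Finset.sum_congr rfl fun i _ => ?_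
  by_cases h : i ∈ B <;> simp [h]

theorem cost_indicator (X B : Set α) : cost (X.indicator 1) B = (B ∩ X).ncard := by
  classical
  rw [cost, Set.indicator_indicator, ncard_eq_toFinset_card', Finset.card_eq_sum_ones,
    Nat.cast_sum, ← Finset.sum_subset (Finset.subset_univ (B ∩ X).toFinset)]
  · exact Finset.sum_congr rfl fun i hi => by
      rw [Set.indicator_of_mem (Set.mem_toFinset.1 hi)]; simp
  · exact fun i _ hi => Set.indicator_of_notMem (fun h => hi (Set.mem_toFinset.2 h)) _

theorem cost_const (t : ℝ) (B : Set α) : cost (fun _ => t) B = t * B.ncard := by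
  have : (fun _ : α => t) = t • (univ : Set α).indicator 1 := by ext; simp
  rw [this, cost_smul, cost_indicator, inter_univ]

theorem cost_insert (w : α → ℝ) {B : Set α} {e : α} (he : e ∉ B) :
    cost w (insert e B) = w e + cost w B := by
  have : ∀ i, (insert e B).indicator w i = ({e} : Set α).indicator w i + B.indicator w i := by
    intro i
    by_cases hi : i = e
    · subst hi; simp [he]
    · by_cases hB : i ∈ B <;> simp [hi, hB]
  rw [cost, cost, Finset.sum_congr rfl fun i _ => this i, Finset.sum_add_distrib]
  congr 1
  rw [Finset.sum_eq_single e] <;> simp +contextual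

theorem cost_exchange (w : α → ℝ) {B : Set α} {e f : α} (he : e ∉ B) (hf : f ∈ B) :
    cost w (insert e B \ {f}) = cost w B + w e - w f := by
  have hef : e ≠ f := fun h => he (h ▸ hf)
  rw [insert_sdiff_of_notMem _ (by simpa using hef), cost_insert w fun h => he h.1]
  have := cost_insert w (B := B \ {f}) (e := f) (by simp)
  rw [insert_sdiff_singleton, insert_eq_of_mem hf] at this
  linarith

theorem continuous_cost (B : Set α) : Continuous fun w : α → ℝ => cost w B := by
  refine continuous_finsetSum _ fun i _ => ?_
  by_cases h : i ∈ B
  · simpa [h] using continuous_apply i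
  · simpa [h] using continuous_const

theorem maxBases_nonempty (M : Matroid α) (w : α → ℝ) : (maxBases M w).Nonempty := by
  obtain ⟨B₀, hB₀⟩ := M.exists_isBase
  obtain ⟨B, hB, hmax⟩ := Set.exists_max_image {B | M.IsBase B} (cost w) (toFinite _) ⟨B₀, hB₀⟩
  exact ⟨B, hB, hmax⟩

theorem exchange_mem_maxBases {B : Set α} (hB : B ∈ maxBases M w) {e f : α} (heE : e ∈ M.E)
    (he : e ∉ B) (hf : f ∈ M.fundCircuit e B) (hef : f ≠ e) (hw : w f ≤ w e) :
    insert e B \ {f} ∈ maxBases M w := by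
  obtain ⟨hfB, hB'⟩ := exchange_isBase hB.1 heE he hf hef
  refine ⟨hB', fun B'' h => (hB.2 B'' h).trans ?_⟩
  rw [cost_exchange w he hfB]
  linarith

theorem le_of_mem_fundCircuit {B : Set α} (hB : B ∈ maxBases M w) {e f : α} (heE : e ∈ M.E)
    (he : e ∉ B) (hf : f ∈ M.fundCircuit e B) : w e ≤ w f := by
  by_cases hef : f = e
  · rw [hef]
  obtain ⟨hfB, hB'⟩ := exchange_isBase hB.1 heE he hf hef
  have := hB.2 _ hB'
  rw [cost_exchange w he hfB] at this
  linarith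

/-- A base of maximal cost spans the superlevel sets of the weight function (the greedy
algorithm). -/
theorem spans_of_mem_maxBases {B U : Set α} (hB : B ∈ maxBases M w) (hU : U ⊆ M.E)
    (hup : ∀ e ∈ U, ∀ f ∉ U, w f < w e) : Spans M B U := by
  intro e he
  by_cases heB : e ∈ B
  · exact M.subset_closure _ (inter_subset_right.trans hU) ⟨heB, he⟩
  rw [Matroid.mem_closure_iff_exists_isCircuit fun h => heB h.1]
  refine ⟨_, fun f hf => ?_, hB.1.fundCircuit_isCircuit (hU he) heB, M.mem_fundCircuit e B⟩
  refine (M.fundCircuit_subset_insert e B hf).imp id fun hfB => ⟨hfB, ?_⟩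
  by_contra hfU
  exact (hup e he f hfU).not_ge (le_of_mem_fundCircuit hB (hU he) heB hf)

theorem spans_level {B : Set α} (hE : M.E = univ) (hB : B ∈ maxBases M w) (t : ℝ) :
    Spans M B {e | t ≤ w e} :=
  spans_of_mem_maxBases hB (hE ▸ subset_univ _) fun _ he _ hf =>
    (not_le.1 hf).trans_le he

/-! ### The Bergman fan -/

theorem mem_bergmanFan_of_isFlat_level [M.Loopless] (h : ∀ t, M.IsFlat {e | t ≤ w e}) :
    w ∈ bergmanFan M := by
  intro C hC
  obtain ⟨i, hi, hmin⟩ := Set.exists_min_image C w (toFinite _) hC.nonempty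
  have hnt : (C \ {i}).Nonempty := by
    obtain ⟨j, hj, hji⟩ := (Matroid.loopless_iff_forall_isCircuit.1 ‹_› C hC).exists_ne i
    exact ⟨j, hj, hji⟩
  obtain ⟨j, hj, hminj⟩ := Set.exists_min_image (C \ {i}) w (toFinite _) hnt
  refine ⟨i, hi, j, hj.1, fun h => hj.2 h.symm, fun k hk => ⟨hmin k hk, ?_⟩⟩
  by_cases hki : k = i
  · have := M.closure_subset_closure (X := C \ {i}) (Y := {e | w j ≤ w e}) hminj
    rw [(h (w j)).closure] at this
    exact hki ▸ this (hC.mem_closure_sdiff_singleton_of_mem hi)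
  · exact hminj k ⟨hk, hki⟩

/-- For `w` in the Bergman fan the matroid `M_w` has no loops: an element `e` outside a base of
maximal cost can be exchanged for an element of minimal weight in its fundamental circuit. -/
theorem exists_mem_maxBases_of_mem_bergmanFan (hw : w ∈ bergmanFan M) {e : α} (he : e ∈ M.E) :
    ∃ B ∈ maxBases M w, e ∈ B := by
  obtain ⟨B, hB⟩ := maxBases_nonempty M w
  by_cases heB : e ∈ B
  · exact ⟨B, hB, heB⟩
  obtain ⟨i, hi, j, hj, hij, hmin⟩ := hw _ (hB.1.fundCircuit_isCircuit he heB)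
  have heC := M.mem_fundCircuit e B
  obtain ⟨k, hkC, hke, hk⟩ : ∃ k ∈ M.fundCircuit e B, k ≠ e ∧ w k ≤ w e := by
    by_cases h : i = e
    · exact ⟨j, hj, fun h' => hij (h.trans h'.symm), (hmin e heC).2⟩
    · exact ⟨i, hi, h, (hmin e heC).1⟩
  exact ⟨_, exchange_mem_maxBases hB he heB hkC hke hk, mem_insert _ _, fun h => hke h.symm⟩

theorem mem_bergmanFan_of_exists_mem_maxBases (h : ∀ e ∈ M.E, ∃ B ∈ maxBases M w, e ∈ B) :
    w ∈ bergmanFan M := by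
  intro C hC
  obtain ⟨i, hi, hmin⟩ := Set.exists_min_image C w (toFinite _) hC.nonempty
  by_contra! hcon
  have hlt : ∀ j ∈ C, j ≠ i → w i < w j := fun j hj hji => by
    obtain ⟨k, hk, hk'⟩ := hcon i hi j hj hji.symm
    exact (hmin k hk).trans_lt (hk' (hmin k hk))
  obtain ⟨B, hB, hiB⟩ := h i (hC.subset_ground hi)
  obtain ⟨g, hgC, hg⟩ : ∃ g ∈ C \ {i}, g ∉ M.closure (B \ {i}) := by
    by_contra! hsub
    exact hB.1.indep.notMem_closure_sdiff_of_mem hiB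
      (M.closure_subset_closure_of_subset_closure hsub (hC.mem_closure_sdiff_singleton_of_mem hi))
  have hgE := hC.subset_ground hgC.1
  have hgB : g ∉ B := fun h => hg (M.mem_closure_of_mem' ⟨h, hgC.2⟩ hgE)
  have hig : i ∈ M.fundCircuit g B := by
    by_contra hcon
    refine hg ((Matroid.mem_closure_iff_exists_isCircuit fun h => hgB h.1).2
      ⟨_, fun x hx => ?_, hB.1.fundCircuit_isCircuit hgE hgB, M.mem_fundCircuit g B⟩)
    exact (M.fundCircuit_subset_insert g B hx).imp id fun hxB => ⟨hxB, fun h => hcon (h ▸ hx)⟩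
  exact (hlt g hgC.1 hgC.2).not_ge (le_of_mem_fundCircuit hB hgE hgB hig)

/-! ### The cones of the normal fan -/

theorem maxBases_add_smul {w' : α → ℝ} (h : maxBases M w ⊆ maxBases M w') {c : ℝ} (hc : 0 < c) :
    maxBases M (w' + c • w) = maxBases M w := by
  obtain ⟨B₀, hB₀⟩ := maxBases_nonempty M w
  have hB₀' := h hB₀
  refine Set.Subset.antisymm (fun B hB => ⟨hB.1, fun B' hB' => (hB₀.2 B' hB').trans ?_⟩)
    fun B hB => ⟨hB.1, fun B' hB' => ?_⟩
  · have h1 := hB.2 B₀ hB₀.1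
    have h2 := hB₀'.2 B hB.1
    rw [cost_add, cost_add, cost_smul, cost_smul] at h1
    exact le_of_mul_le_mul_left (by linarith) hc
  · rw [cost_add, cost_add, cost_smul, cost_smul]
    exact add_le_add ((h hB).2 B' hB') (mul_le_mul_of_nonneg_left (hB.2 B' hB') hc.le)

/-- The closed cone of `w` consists of the `w'` for which all bases of `M_w` are bases of `M_w'`:
adding a small positive multiple of `w` to such a `w'` singles out the bases of `M_w`. -/
theorem normalCone_eq (M : Matroid α) (w : α → ℝ) :
    normalCone M w = {w' | maxBases M w ⊆ maxBases M w'} := by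
  refine Set.Subset.antisymm (closure_minimal (fun w' hw' => ?_) ?_) fun w' hw' => ?_
  · exact (show maxBases M w' = maxBases M w from hw').symm.subset
  · have : {w' | maxBases M w ⊆ maxBases M w'} =
        ⋂ B ∈ maxBases M w, ⋂ B' ∈ {B' | M.IsBase B'}, {w' | cost w' B' ≤ cost w' B} := by
      ext w'
      simp only [mem_iInter]
      exact ⟨fun h B hB B' hB' => (h hB).2 B' hB', fun h B hB => ⟨hB.1, fun B' hB' => h B hB B' hB'⟩⟩
    rw [this]
    exact isClosed_biInter fun B _ => isClosed_biInter fun B' _ =>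
      isClosed_le (continuous_cost B') (continuous_cost B)
  · have ht : Filter.Tendsto (fun c : ℝ => w' + c • w) (nhdsWithin 0 (Ioi 0)) (nhds w') := by
      have : Continuous fun c : ℝ => w' + c • w := by fun_prop
      have h := this.tendsto 0
      simp only [zero_smul, add_zero] at h
      exact h.mono_left nhdsWithin_le_nhds
    refine mem_closure_of_tendsto ht ?_
    filter_upwards [self_mem_nhdsWithin] with c hc
    exact maxBases_add_smul hw' hc

theorem bergmanFan_of_maxBases_subset {w' : α → ℝ} (hw : w ∈ bergmanFan M)
    (h : maxBases M w ⊆ maxBases M w') : w' ∈ bergmanFan M :=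
  mem_bergmanFan_of_exists_mem_maxBases fun _ he =>
    (exists_mem_maxBases_of_mem_bergmanFan hw he).imp fun _ hB => ⟨h hB.1, hB.2⟩

/-- If `u` has constant cost on the bases of `M_w`, then `w` can be moved a little in the
directions `u` and `-u` without leaving the cone of `w`. -/
theorem exists_pos_maxBases_subset {u : α → ℝ}
    (hu : ∀ B ∈ maxBases M w, ∀ B' ∈ maxBases M w, cost u B = cost u B') :
    ∃ c : ℝ, 0 < c ∧ c < 1 ∧ maxBases M w ⊆ maxBases M (w + c • u) ∧
      maxBases M w ⊆ maxBases M (w + (-c) • u) := by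
  have hcont : ∀ B, Continuous fun c : ℝ => cost (w + c • u) B := fun B =>
    (continuous_cost B).comp (by fun_prop)
  have hev : ∀ᶠ c in nhds (0 : ℝ), maxBases M w ⊆ maxBases M (w + c • u) := by
    have : ∀ᶠ c in nhds (0 : ℝ), ∀ B, B ∈ maxBases M w → ∀ B', M.IsBase B' →
        cost (w + c • u) B' ≤ cost (w + c • u) B := by
      refine Filter.eventually_all.2 fun B => Filter.eventually_imp_distrib_left.2 fun hB =>
        Filter.eventually_all.2 fun B' => Filter.eventually_imp_distrib_left.2 fun hB' => ?_
      by_cases hmem : B' ∈ maxBases M w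
      · refine Filter.Eventually.of_forall fun c => ?_
        rw [cost_add, cost_add, cost_smul, cost_smul, hu B hB B' hmem]
        linarith [hB.2 B' hB']
      · have hlt : cost w B' < cost w B := by
          refine lt_of_le_of_ne (hB.2 B' hB') fun h => hmem ⟨hB', fun B'' h'' => ?_⟩
          exact h ▸ hB.2 B'' h''
        have := (hcont B').continuousAt.eventually_lt (hcont B).continuousAt (x₀ := 0) (by simpa)
        exact this.mono fun c hc => hc.le
    exact this.mono fun c hc B hB => ⟨hB.1, hc B hB⟩
  have hneg : ∀ᶠ c in nhds (0 : ℝ), maxBases M w ⊆ maxBases M (w + (-c) • u) := by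
    have : Filter.Tendsto (fun c : ℝ => -c) (nhds 0) (nhds 0) := by
      simpa using (continuous_neg (G := ℝ)).tendsto 0
    exact this.eventually hev
  have h1 : ∀ᶠ c in nhds (0 : ℝ), c < 1 := eventually_lt_nhds one_pos
  obtain ⟨c, hc, hc0⟩ := (((hev.and hneg).and h1).filter_mono
    (nhdsWithin_le_nhds (s := Ioi 0))).and self_mem_nhdsWithin |>.exists
  exact ⟨c, hc0, hc.2, hc.1.1, hc.1.2⟩

end Cost

/-! ### The cones of the nested set complex -/

section NestedCone

variable {M : Matroid α}

/-- The cone over the spherical simplex of `S`, including its lineality space `ℝ(1, …, 1)`. -/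
def nestedCone (S : Set (Flats M)) : Set (α → ℝ) :=
  {w | ∃ v ∈ PointedCone.hull ℝ (incidenceVector '' S), ∃ t : ℝ, w = v + fun _ => t}

theorem sphericalSimplex_eq [Fintype α] (S : Set (Flats M)) :
    sphericalSimplex S = nestedCone S ∩ sphere α :=
  Set.ext fun _ => and_comm

theorem const_mem_nestedCone (S : Set (Flats M)) (t : ℝ) : (fun _ => t) ∈ nestedCone S :=
  ⟨0, zero_mem _, t, by simp⟩

theorem add_mem_nestedCone {S : Set (Flats M)} {v v' : α → ℝ} (h : v ∈ nestedCone S)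
    (h' : v' ∈ nestedCone S) : v + v' ∈ nestedCone S := by
  obtain ⟨x, hx, t, rfl⟩ := h
  obtain ⟨x', hx', t', rfl⟩ := h'
  exact ⟨x + x', add_mem hx hx', t + t', by ext; simp; ring⟩

theorem smul_mem_nestedCone {S : Set (Flats M)} {v : α → ℝ} {c : ℝ} (hc : 0 ≤ c)
    (h : v ∈ nestedCone S) : c • v ∈ nestedCone S := by
  obtain ⟨x, hx, t, rfl⟩ := h
  exact ⟨c • x, PointedCone.smul_mem _ hc hx, c * t, by ext; simp; ring⟩

theorem incidenceVector_mem_nestedCone {S : Set (Flats M)} {X : Flats M} (hX : X ∈ S) :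
    incidenceVector X ∈ nestedCone S :=
  ⟨_, PointedCone.subset_hull ⟨X, hX, rfl⟩, 0, by ext; simp⟩

theorem nestedCone_induction {S : Set (Flats M)} {K : Set (α → ℝ)}
    (hconst : ∀ t : ℝ, (fun _ => t) ∈ K) (hadd : ∀ v ∈ K, ∀ v' ∈ K, v + v' ∈ K)
    (hsmul : ∀ c : ℝ, 0 ≤ c → ∀ v ∈ K, c • v ∈ K) (hinc : ∀ X ∈ S, incidenceVector X ∈ K) :
    nestedCone S ⊆ K := by
  rintro _ ⟨v, hv, t, rfl⟩
  refine hadd _ ?_ _ (hconst t)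
  induction hv using Submodule.span_induction with
  | mem x h => obtain ⟨X, hX, rfl⟩ := h; exact hinc X hX
  | zero => exact hconst 0
  | add x y _ _ hx hy => exact hadd x hx y hy
  | smul c x _ hx => exact hsmul c c.2 x hx

theorem nestedCone_subset {S S' : Set (Flats M)}
    (h : ∀ X ∈ S, incidenceVector X ∈ nestedCone S') : nestedCone S ⊆ nestedCone S' :=
  nestedCone_induction (const_mem_nestedCone S') (fun _ hv _ hv' => add_mem_nestedCone hv hv')
    (fun _ hc _ hv => smul_mem_nestedCone hc hv) h

theorem nestedCone_mono {S S' : Set (Flats M)} (h : S ⊆ S') : nestedCone S ⊆ nestedCone S' :=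
  nestedCone_subset fun _ hX => incidenceVector_mem_nestedCone (h hX)

theorem nestedCone_diff_top (hE : M.E = univ) (S : Set (Flats M)) :
    nestedCone (S \ {⊤}) = nestedCone S := by
  refine (nestedCone_mono sdiff_subset).antisymm (nestedCone_subset fun X hX => ?_)
  by_cases h : X = ⊤
  · have : incidenceVector X = fun _ => (1 : ℝ) := by
      ext e
      have he : e ∈ X.1 := h ▸ (hE ▸ mem_univ e : e ∈ M.E)
      simp [incidenceVector, he]
    exact this ▸ const_mem_nestedCone _ 1
  · exact incidenceVector_mem_nestedCone ⟨hX, h⟩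

theorem exists_eq_sum_of_mem_nestedCone {S : Set (Flats M)} {T : Finset (Flats M)}
    (hT : S ⊆ T) {v : α → ℝ} (hv : v ∈ nestedCone S) :
    ∃ (c : Flats M → ℝ) (t : ℝ), (∀ X, 0 ≤ c X) ∧
      v = ∑ X ∈ T, c X • incidenceVector X + fun _ => t := by
  classical
  refine nestedCone_induction (K := {v | ∃ (c : Flats M → ℝ) (t : ℝ), (∀ X, 0 ≤ c X) ∧
      v = ∑ X ∈ T, c X • incidenceVector X + fun _ => t}) ?_ ?_ ?_ ?_ hv
  · exact fun t => ⟨0, t, fun _ => le_rfl, by simp⟩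
  · rintro _ ⟨c, t, hc, rfl⟩ _ ⟨c', t', hc', rfl⟩
    refine ⟨c + c', t + t', fun X => add_nonneg (hc X) (hc' X), ?_⟩
    ext e
    simp [add_mul, Finset.sum_add_distrib]
    ring
  · rintro a ha _ ⟨c, t, hc, rfl⟩
    refine ⟨a • c, a * t, fun X => mul_nonneg ha (hc X), ?_⟩
    ext e
    simp [mul_add, Finset.mul_sum, mul_assoc]
  · intro X hX
    refine ⟨Pi.single X 1, 0, fun Y => ?_, ?_⟩
    · by_cases h : Y = X
      · subst h; simp
      · simp [h]
    · rw [Finset.sum_eq_single X]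
      · ext; simp
      · intro Y _ hY; simp [hY]
      · exact fun h => (h (hT hX)).elim

/-- A function is a nonnegative combination of the indicators of its superlevel sets, up to a
constant. By induction on the set of values, truncating at the second largest one. -/
theorem mem_of_indicator_level_mem {K : Set (α → ℝ)}
    (hconst : ∀ t : ℝ, (fun _ => t) ∈ K) (hadd : ∀ v ∈ K, ∀ v' ∈ K, v + v' ∈ K)
    (hsmul : ∀ c : ℝ, 0 ≤ c → ∀ v ∈ K, c • v ∈ K) (V : Finset ℝ) :
    ∀ w : α → ℝ, (∀ e, w e ∈ V) → (∀ t, {e | t ≤ w e}.indicator 1 ∈ K) → w ∈ K := by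
  induction V using Finset.induction_on_max with
  | empty =>
    intro w hw _
    have : w = fun _ => 0 := funext fun e => absurd (hw e) (Finset.notMem_empty _)
    exact this ▸ hconst 0
  | insert a s ha ih =>
    intro w hw hlev
    obtain rfl | hs := s.eq_empty_or_nonempty
    · have : w = fun _ => a := funext fun e => by simpa using hw e
      exact this ▸ hconst a
    set m := s.max' hs
    have hma : m < a := ha m (s.max'_mem hs)
    have hle : ∀ e, w e ≠ a → w e ∈ s ∧ w e ≤ m := fun e he => by
      have := (Finset.mem_insert.1 (hw e)).resolve_left he
      exact ⟨this, s.le_max' _ this⟩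
    have hdec : w = (fun e => min (w e) m) + (a - m) • {e | a ≤ w e}.indicator 1 := by
      ext e
      by_cases he : w e = a
      · have h1 : e ∈ {e | a ≤ w e} := he.ge
        simp [he, hma.le, h1]
      · have h1 : e ∉ {e | a ≤ w e} := fun h => ((hle e he).2.trans_lt hma).not_ge h
        simp [(hle e he).2, h1]
    rw [hdec]
    refine hadd _ (ih _ (fun e => ?_) fun t => ?_) _ (hsmul _ (sub_nonneg.2 hma.le) _ (hlev a))
    · by_cases he : w e = a
      · rw [he, min_eq_right hma.le]
        exact s.max'_mem hs
      · rw [min_eq_left (hle e he).2]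
        exact (hle e he).1
    · by_cases htm : t ≤ m
      · simpa [htm] using hlev t
      · have : {e | t ≤ min (w e) m} = ∅ := eq_empty_of_forall_notMem fun e he =>
          htm (le_min_iff.1 he).2
        rw [this, indicator_empty]
        exact hconst 0

end NestedCone

/-! ### The components of the level sets of a weight function -/

section LevelComponents

variable [Fintype α] {M : Matroid α} {w : α → ℝ}

variable (M) in
/-- The connected components of the superlevel sets of `w`, as flats. -/
def levelComponents (w : α → ℝ) : Set (Flats M) :=
  {X | ∃ (t : ℝ) (e : α), t ≤ w e ∧ X.1 = component (M ↾ {f | t ≤ w f}) e}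

theorem spans_levelComponents (hE : M.E = univ) {B : Set α} (hB : B ∈ maxBases M w) {X : Flats M}
    (hX : X ∈ levelComponents M w) : Spans M B X.1 := by
  obtain ⟨t, e, -, hX⟩ := hX
  have hU : {f | t ≤ w f} ⊆ M.E := hE ▸ subset_univ _
  exact hX ▸ (spans_level hE hB t).circuitClosed hU (circuitClosed_component hU e)

/-- The bases of `M_w` span the level components of `w`, so they also have maximal cost for
nonnegative combinations of the incidence vectors of these components. -/
theorem maxBases_subset_of_mem_nestedCone (hE : M.E = univ) {w' : α → ℝ}
    (h : w' ∈ nestedCone (levelComponents M w)) : maxBases M w ⊆ maxBases M w' := by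
  refine fun B hB => ⟨hB.1, ?_⟩
  refine nestedCone_induction (K := {w' | ∀ B', M.IsBase B' → cost w' B' ≤ cost w' B})
    ?_ ?_ ?_ ?_ h
  · intro t B' hB'
    rw [cost_const, cost_const, hB'.ncard_eq_ncard_of_isBase hB.1]
  · intro v hv v' hv' B' hB'
    rw [cost_add, cost_add]
    exact add_le_add (hv B' hB') (hv' B' hB')
  · intro c hc v hv B' hB'
    rw [cost_smul, cost_smul]
    exact mul_le_mul_of_nonneg_left (hv B' hB') hc
  · intro X hX B' hB'
    rw [incidenceVector, cost_indicator, cost_indicator]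
    exact_mod_cast (spans_levelComponents hE hB hX).ncard_inter_le hB.1.indep hB'.indep

theorem indicator_level_mem_nestedCone [M.Loopless] (hE : M.E = univ) (hw : w ∈ bergmanFan M)
    (t : ℝ) : {e | t ≤ w e}.indicator 1 ∈ nestedCone (levelComponents M w) := by
  classical
  set U := {e | t ≤ w e} with hU
  have hUE : U ⊆ M.E := hE ▸ subset_univ _
  let T := (toFinite {X : Flats M | ∃ e ∈ U, X.1 = component (M ↾ U) e}).toFinset
  have hT : ∀ X, X ∈ T ↔ ∃ e ∈ U, X.1 = component (M ↾ U) e := fun X => Set.Finite.mem_toFinset _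
  have hsum : U.indicator 1 = ∑ X ∈ T, (incidenceVector X : α → ℝ) := by
    ext e
    rw [Finset.sum_apply]
    by_cases he : e ∈ U
    · have hself := mem_component_self (N := M ↾ U) he
      rw [Finset.sum_eq_single ⟨component (M ↾ U) e, isFlat_component (isFlat_level hE hw t) e⟩]
      · simp [incidenceVector, he, hself]
      · intro X hX hne
        obtain ⟨f, -, hf⟩ := (hT X).1 hX
        refine indicator_of_notMem (fun heX => hne (Subtype.ext ?_)) _
        rw [hf] at heX
        exact hf.trans (component_eq_of_mem heX).symm
      · exact fun h => (h ((hT _).2 ⟨e, he, rfl⟩)).elim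
    · rw [indicator_of_notMem he, Finset.sum_eq_zero]
      intro X hX
      obtain ⟨f, -, hf⟩ := (hT X).1 hX
      refine indicator_of_notMem (fun heX => he ?_) _
      rw [hf] at heX
      exact component_restrict_subset M U f heX
  refine ⟨∑ X ∈ T, incidenceVector X, ?_, 0, by rw [hsum]; ext; simp⟩
  refine Submodule.sum_mem _ fun X hX => PointedCone.subset_hull (mem_image_of_mem _ ?_)
  obtain ⟨e, he, h⟩ := (hT X).1 hX
  exact ⟨t, e, he, h⟩

theorem self_mem_nestedCone [M.Loopless] (hE : M.E = univ) (hw : w ∈ bergmanFan M) :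
    w ∈ nestedCone (levelComponents M w) := by
  classical
  exact mem_of_indicator_level_mem (const_mem_nestedCone _)
    (fun _ hv _ hv' => add_mem_nestedCone hv hv') (fun _ hc _ hv => smul_mem_nestedCone hc hv)
    (Finset.univ.image w) w (fun e => Finset.mem_image_of_mem w (Finset.mem_univ e))
    (indicator_level_mem_nestedCone hE hw)

end LevelComponents

/-! ### Level components form a nested set -/

section LevelNested

variable [Fintype α] {M : Matroid α} {w : α → ℝ}

omit [Fintype α] in
theorem isConnected_restrict_top (hM : IsConnected M) : IsConnected (M ↾ (⊤ : Flats M).1) := by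
  rwa [show (⊤ : Flats M).1 = M.E from rfl, Matroid.restrict_ground_eq_self]

theorem top_mem_levelComponents (hE : M.E = univ) (hM : IsConnected M) (w : α → ℝ) :
    ⊤ ∈ levelComponents M w := by
  obtain ⟨e, -, he⟩ := Set.exists_min_image univ w (toFinite _) (hE ▸ hM.1)
  have h : {f | w e ≤ w f} = (⊤ : Flats M).1 :=
    Set.Subset.antisymm (fun f _ => (hE ▸ mem_univ f : f ∈ M.E)) fun f _ => he f (mem_univ f)
  refine ⟨w e, e, le_rfl, ?_⟩
  rw [h]
  exact (component_eq_self Subset.rfl (isConnected_restrict_top hM)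
    (hE ▸ mem_univ e : e ∈ M.E)).symm

theorem isConnected_of_mem_levelComponents (hE : M.E = univ) {X : Flats M}
    (hX : X ∈ levelComponents M w) : IsConnected (M ↾ X.1) := by
  obtain ⟨t, e, he, hX⟩ := hX
  exact hX ▸ isConnected_component (hE ▸ subset_univ _) he

/-- If the join of level components is connected, then it lies in the one of lowest level. -/
theorem levelComponents_diff_top_mem [M.Loopless] (hE : M.E = univ) (hM : IsConnected M)
    (hw : w ∈ bergmanFan M) : levelComponents M w \ {⊤} ∈ minNestedSetComplex M := by
  refine ⟨fun h => h.2 rfl, ?_⟩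
  have hins : insert ⊤ (levelComponents M w \ {⊤}) = levelComponents M w := by
    rw [insert_sdiff_singleton, insert_eq_of_mem (top_mem_levelComponents hE hM w)]
  rw [hins]
  refine ⟨fun X hX => isConnectedElement_iff.2 (isConnected_of_mem_levelComponents hE hX),
    fun T hT hanti hcard hmem => ?_⟩
  have hJ := isConnectedElement_iff.1 hmem
  obtain ⟨e, heJ, hmin⟩ := Set.exists_min_image (T.sup id).1 w (toFinite _) hJ.1
  obtain ⟨X, hXT, f, hfX, hfe⟩ : ∃ X ∈ T, ∃ f ∈ X.1, w f ≤ w e := by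
    by_contra! hcon
    have hV : M.IsFlat {f | w e < w f} := isFlat_of_mem_bergmanFan hw (hE ▸ subset_univ _)
      fun a ha b hb => (not_lt.1 hb).trans_lt ha
    have : T.sup id ≤ ⟨_, hV⟩ := Finset.sup_le fun X hX f hf => hcon X hX f hf
    exact lt_irrefl (w e) (this heJ)
  obtain ⟨t, g, hg, hX⟩ := hT hXT
  have hUE : {f | t ≤ w f} ⊆ M.E := hE ▸ subset_univ _
  have htf : t ≤ w f := component_restrict_subset M _ g (hX ▸ hfX)
  have hJU : (T.sup id).1 ⊆ {f | t ≤ w f} := fun a ha => (htf.trans hfe).trans (hmin a ha)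
  have hXJ : X ≤ T.sup id := Finset.le_sup (f := id) hXT
  have hJX : T.sup id ≤ X :=
    (subset_component hUE hJU hJ (hXJ hfX) (hX ▸ hfX)).trans hX.symm.subset
  have : T ⊆ {X} := fun Y hY => Finset.mem_singleton.2
    (hanti.eq hY hXT ((Finset.le_sup (f := id) hY).trans hJX))
  have := Finset.card_le_card this
  rw [Finset.card_singleton] at this
  omega

/-- If every interval of flats with connected upper end is connected, then a connected
flat spanned by all bases of `M_w` is a component of a superlevel set of `w`. -/
theorem mem_levelComponents_of_spans [M.Loopless] (hE : M.E = univ)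
    (hH : ∀ F G : Set α, M.IsFlat F → M.IsFlat G → F ⊂ G → IsConnected (M ↾ G) →
      IsConnected (interval M F G))
    (hw : w ∈ bergmanFan M) {X : Flats M} (hXc : IsConnected (M ↾ X.1))
    (hX : ∀ B ∈ maxBases M w, Spans M B X.1) : X ∈ levelComponents M w := by
  have hXE := X.2.subset_ground
  obtain ⟨e, heX, hmin⟩ := Set.exists_min_image X.1 w (toFinite _) hXc.1
  set s := w e with hs
  set U := {f | s ≤ w f} with hU
  set V := {f | s < w f} with hV
  have hUE : U ⊆ M.E := hE ▸ subset_univ _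
  have hVE : V ⊆ M.E := hE ▸ subset_univ _
  have hVup : ∀ a ∈ V, ∀ b ∉ V, w b < w a := fun a ha b hb => (not_lt.1 hb).trans_lt ha
  have heU : e ∈ U := le_refl s
  -- the smallest level component containing `X`, and the part of it on higher levels
  set G := component (M ↾ U) e with hGdef
  set F := G ∩ V with hFdef
  have hGflat : M.IsFlat G := isFlat_component (isFlat_level hE hw s) e
  have hGE := hGflat.subset_ground
  have hFflat : M.IsFlat F := isFlat_inter hGflat (isFlat_of_mem_bergmanFan hw hVE hVup)
  have hGc : IsConnected (M ↾ G) := isConnected_component hUE heU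
  have hXG : X.1 ⊆ G :=
    subset_component hUE hmin hXc heX (mem_component_self (N := M ↾ U) heU)
  have heF : e ∉ F := fun h => lt_irrefl s h.2
  have hFG : F ⊆ G := inter_subset_left
  have hlevel : ∀ g ∈ G, g ∉ F → w g = s := fun g hg hgF =>
    (not_lt.1 fun h => hgF ⟨hg, h⟩).antisymm (component_restrict_subset M U e hg)
  obtain ⟨B, hB⟩ := maxBases_nonempty M w
  have hBG : Spans M B G :=
    (spans_level hE hB s).circuitClosed hUE (circuitClosed_component hUE e)
  have hBF : Spans M B F := hBG.inter (spans_of_mem_maxBases hB hVE hVup) hB.1.indep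
  have hBX := hX B hB
  -- exchanging elements of `X \ F` and `G \ (X ∪ F)` preserves the cost, but changes `|B ∩ X|`
  have hBY : Spans M B (F ∪ G \ X.1) := by
    rintro g (hgF | ⟨hgG, hgX⟩)
    · exact M.closure_subset_closure (inter_subset_inter_right _ subset_union_left) (hBF hgF)
    by_cases hgF : g ∈ F
    · exact M.closure_subset_closure (inter_subset_inter_right _ subset_union_left) (hBF hgF)
    by_contra hg
    have hgB : g ∉ B := fun h => hg (M.mem_closure_of_mem' ⟨h, Or.inr ⟨hgG, hgX⟩⟩ (hGE hgG))
    obtain ⟨C, hCs, hC, hgC⟩ :=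
      (Matroid.mem_closure_iff_exists_isCircuit fun h => hgB h.1).1 (hBG hgG)
    have hCf : C = M.fundCircuit g B := hC.eq_fundCircuit_of_subset hB.1.indep
      (hCs.trans (insert_subset_insert inter_subset_left))
    obtain ⟨f, hfC, hfY⟩ : ∃ f ∈ C, f ∉ insert g (B ∩ (F ∪ G \ X.1)) := by
      by_contra! hcon
      exact hg ((Matroid.mem_closure_iff_exists_isCircuit fun h => hgB h.1).2
        ⟨C, hcon, hC, hgC⟩)
    have hfg : f ≠ g := fun h => hfY (Or.inl h)
    have hfBG : f ∈ B ∩ G := (hCs hfC).resolve_left hfg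
    have hfF : f ∉ F := fun h => hfY (Or.inr ⟨hfBG.1, Or.inl h⟩)
    have hfX : f ∈ X.1 := by
      by_contra h
      exact hfY (Or.inr ⟨hfBG.1, Or.inr ⟨hfBG.2, h⟩⟩)
    have hB' := exchange_mem_maxBases hB (hGE hgG) hgB (hCf ▸ hfC) hfg
      (((hlevel f hfBG.2 hfF).trans (hlevel g hgG hgF).symm).le)
    refine hB.1.indep.notMem_closure_sdiff_of_mem hfBG.1
      (M.closure_subset_closure ?_ (hX _ hB' hfX))
    rintro a ⟨⟨rfl | haB, haf⟩, haX⟩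
    exacts [(hgX haX).elim, ⟨haB, haf⟩]
  -- `M[F, G]` splits into `X \ F` and the rest of `G \ F`, so the rest is empty
  have hinter : (X.1 ∪ F) ∩ (F ∪ G \ X.1) = F := by
    ext a
    simp only [mem_inter_iff, mem_union, mem_sdiff]
    tauto
  have hunion : (X.1 ∪ F) ∪ (F ∪ G \ X.1) = G := by
    refine Set.Subset.antisymm (union_subset (union_subset hXG hFG)
      (union_subset hFG sdiff_subset)) fun a ha => ?_
    by_cases haX : a ∈ X.1
    exacts [Or.inl (Or.inl haX), Or.inr (Or.inr ⟨ha, haX⟩)]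
  have hGXF : G ⊆ X.1 ∪ F := by
    intro g hg
    by_contra hgXF
    have hgF : g ∉ F := fun h => hgXF (Or.inr h)
    obtain rfl | ⟨C, hC, heC, hgC⟩ := (hH F G hFflat hGflat ⟨hFG, fun h => heF (h (hXG heX))⟩
      hGc).2 e ⟨hXG heX, heF⟩ g ⟨hg, hgF⟩
    · exact hgXF (Or.inl heX)
    have hC' : (interval M ((X.1 ∪ F) ∩ (F ∪ G \ X.1)) (X.1 ∪ F ∪ (F ∪ G \ X.1))).IsCircuit C := by
      rwa [hinter, hunion]
    refine Spans.not_isCircuit_crossing hB.1.indep (hBX.union hBF) hBY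
      (union_subset hXE hFflat.subset_ground)
      (union_subset hFflat.subset_ground (sdiff_subset.trans hGE)) hC' heC ?_ hgC hgXF
    rintro (h | h)
    exacts [heF h, h.2 heX]
  -- now `M[X ∩ F, G]` splits into `X \ F` and `F \ X`, so `F \ X` is empty
  have hGX : G ⊆ X.1 := by
    intro g hg
    by_contra hgX
    have hgF : g ∈ F := (hGXF hg).resolve_left hgX
    have hXF : X.1 ∪ F = G := (union_subset hXG hFG).antisymm hGXF
    obtain rfl | ⟨C, hC, heC, hgC⟩ := (hH (X.1 ∩ F) G (isFlat_inter X.2 hFflat) hGflat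
      ⟨inter_subset_right.trans hFG, fun h => hgX (h hg).1⟩ hGc).2 e
      ⟨hXG heX, fun h => heF h.2⟩ g ⟨hg, fun h => hgX h.1⟩
    · exact hgX heX
    exact Spans.not_isCircuit_crossing hB.1.indep hBX hBF hXE hFflat.subset_ground
      (hXF.symm ▸ hC) heC heF hgC hgX
  exact ⟨s, e, le_rfl, hXG.antisymm hGX⟩

theorem normalCone_eq_nestedCone [M.Loopless] (hE : M.E = univ)
    (hH : ∀ F G : Set α, M.IsFlat F → M.IsFlat G → F ⊂ G → IsConnected (M ↾ G) →
      IsConnected (interval M F G))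
    (hw : w ∈ bergmanFan M) : normalCone M w = nestedCone (levelComponents M w \ {⊤}) := by
  rw [normalCone_eq, nestedCone_diff_top hE]
  refine Set.Subset.antisymm (fun w' hw' => ?_) fun w' => maxBases_subset_of_mem_nestedCone hE
  refine nestedCone_mono (fun X hX => ?_)
    (self_mem_nestedCone hE (bergmanFan_of_maxBases_subset hw hw'))
  exact mem_levelComponents_of_spans hE hH hw (isConnected_of_mem_levelComponents hE hX)
    fun B hB => spans_levelComponents hE (hw' hB) hX

end LevelNested

/-! ### Weight functions supported on nested sets -/

section NestedWeights

variable [Finite α] {M : Matroid α} [M.Loopless] {S : Set (Flats M)} {T : Finset (Flats M)}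
  {c : Flats M → ℝ}

open Classical in
/-- In a positive combination of the incidence vectors of a nested set, the superlevel set of a
positive number is the union of an antichain: the maximal `X` for which the sum of the coefficients
above `X` is large enough. -/
theorem IsNested.level_eq (hS : IsNested (minBuildingSet (Flats M)) S) (hTS : (T : Set _) ⊆ S)
    (hc : ∀ X ∈ T, 0 < c X) {r : ℝ} (hr : 0 < r) :
    {e | r ≤ ∑ Y ∈ T with e ∈ Y.1, c Y} =
      ⋃ X ∈ T.filter (Maximal fun X => X ∈ T ∧ r ≤ ∑ Y ∈ T with X ≤ Y, c Y), X.1 := by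
  ext e
  simp only [mem_ofPred, mem_iUnion, Finset.mem_filter, exists_prop]
  constructor
  · intro he
    have hne : (T.filter fun Y => e ∈ Y.1).Nonempty := by
      by_contra h
      rw [Finset.not_nonempty_iff_eq_empty.1 h, Finset.sum_empty] at he
      exact hr.not_ge he
    obtain ⟨X, hX⟩ := (T.filter fun Y => e ∈ Y.1).exists_minimal hne
    have hXT := Finset.mem_filter.1 hX.1
    have hXr : r ≤ ∑ Y ∈ T with X ≤ Y, c Y := by
      refine he.trans (Finset.sum_le_sum_of_subset_of_nonneg (fun Y hY => ?_)
        fun Y hY _ => (hc Y (Finset.mem_filter.1 hY).1).le)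
      have hYT := Finset.mem_filter.1 hY
      refine Finset.mem_filter.2 ⟨hYT.1, ?_⟩
      exact (hS.le_or_le (hTS hXT.1) (hTS hYT.1) hXT.2 hYT.2).elim id fun h => hX.2 hY h
    obtain ⟨Y, hXY, hY⟩ := (T.filter fun X => r ≤ ∑ Y ∈ T with X ≤ Y, c Y).exists_le_maximal
      (Finset.mem_filter.2 ⟨hXT.1, hXr⟩)
    simp only [Finset.mem_filter] at hY
    exact ⟨Y, ⟨hY.1.1, hY⟩, hXY hXT.2⟩
  · rintro ⟨X, ⟨-, hX⟩, heX⟩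
    refine hX.1.2.trans (Finset.sum_le_sum_of_subset_of_nonneg (fun Y hY => ?_)
      fun Y hY _ => (hc Y (Finset.mem_filter.1 hY).1).le)
    have hY' := Finset.mem_filter.1 hY
    exact Finset.mem_filter.2 ⟨hY'.1, hY'.2 heX⟩

omit [Finite α] [M.Loopless] in
open Classical in
theorem sum_incidenceVector_apply (T : Finset (Flats M)) (c : Flats M → ℝ) (t : ℝ) (e : α) :
    (∑ X ∈ T, c X • incidenceVector X + fun _ => t : α → ℝ) e = ∑ Y ∈ T with e ∈ Y.1, c Y + t := by
  rw [Pi.add_apply, Finset.sum_apply, Finset.sum_filter]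
  congr 1
  refine Finset.sum_congr rfl fun X _ => ?_
  by_cases h : e ∈ X.1 <;> simp [incidenceVector, h]

/-- The superlevel sets of a positive combination of the incidence vectors of a nested set are
flats, whose components belong to the nested set or are the whole ground set. -/
theorem IsNested.component_level (hE : M.E = univ) (hM : IsConnected M)
    (hS : IsNested (minBuildingSet (Flats M)) S) (hTS : (T : Set _) ⊆ S)
    (hc : ∀ X ∈ T, 0 < c X) {w : α → ℝ} {t₀ : ℝ}
    (hw : w = ∑ X ∈ T, c X • incidenceVector X + fun _ => t₀) (t : ℝ) :
    M.IsFlat {e | t ≤ w e} ∧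
      ∀ e, t ≤ w e → ∃ X : Flats M, X.1 = component (M ↾ {e | t ≤ w e}) e ∧ (X ∈ T ∨ X = ⊤) := by
  classical
  have hw' : ∀ e, w e = ∑ Y ∈ T with e ∈ Y.1, c Y + t₀ := fun e => by
    rw [hw, sum_incidenceVector_apply]
  obtain hr | hr := le_or_gt (t - t₀) 0
  · have : {e | t ≤ w e} = (⊤ : Flats M).1 :=
      Set.Subset.antisymm (fun f _ => (hE ▸ mem_univ f : f ∈ M.E)) fun e _ => by
        have h0 : 0 ≤ ∑ Y ∈ T with e ∈ Y.1, c Y :=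
          Finset.sum_nonneg fun Y hY => (hc Y (Finset.mem_filter.1 hY).1).le
        rw [mem_ofPred, hw']
        linarith
    rw [this]
    refine ⟨(⊤ : Flats M).2, fun e _ => ⟨⊤, ?_, Or.inr rfl⟩⟩
    exact (component_eq_self Subset.rfl (isConnected_restrict_top hM)
      (hE ▸ mem_univ e : e ∈ M.E)).symm
  · have hlev : {e | t ≤ w e} = {e | t - t₀ ≤ ∑ Y ∈ T with e ∈ Y.1, c Y} := by
      ext e
      rw [mem_ofPred, mem_ofPred, hw', sub_le_iff_le_add]
    rw [hlev, hS.level_eq hTS hc hr]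
    have hcomp := hS.component_biUnion (T := T.filter (Maximal fun X => X ∈ T ∧
      t - t₀ ≤ ∑ Y ∈ T with X ≤ Y, c Y)) (fun X hX => hTS (Finset.mem_filter.1 hX).1)
      (fun X hX Y hY hne h => hne (h.antisymm
        ((Finset.mem_filter.1 hX).2.2 (Finset.mem_filter.1 hY).2.1 h)))
    refine ⟨hcomp.1, fun e he => ?_⟩
    have he' : e ∈ {e | t ≤ w e} := he
    rw [hlev, hS.level_eq hTS hc hr] at he'
    obtain ⟨X, hX, heX⟩ := mem_iUnion₂.1 he'
    exact ⟨X, (hcomp.2 X hX e heX).symm, Or.inl (Finset.mem_filter.1 hX).1⟩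

/-- The members of a nested set are components of superlevel sets of a positive combination of
their incidence vectors. -/
theorem IsNested.mem_levelComponents (hS : IsNested (minBuildingSet (Flats M)) S)
    (hTS : (T : Set _) ⊆ S) (hc : ∀ X ∈ T, 0 < c X) {w : α → ℝ} {t₀ : ℝ}
    (hw : w = ∑ X ∈ T, c X • incidenceVector X + fun _ => t₀) {X : Flats M} (hX : X ∈ T) :
    X ∈ levelComponents M w := by
  classical
  set r := ∑ Y ∈ T with X ≤ Y, c Y with hrdef
  have hpos : ∀ Z, ∀ Y ∈ T.filter (fun Y => Z ≤ Y), 0 ≤ c Y := fun Z Y hY =>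
    (hc Y (Finset.mem_filter.1 hY).1).le
  have hr : 0 < r := (hc X hX).trans_le
    (Finset.single_le_sum (hpos X) (Finset.mem_filter.2 ⟨hX, le_rfl⟩))
  have hlev : {e | r + t₀ ≤ w e} = {e | r ≤ ∑ Y ∈ T with e ∈ Y.1, c Y} := by
    ext e
    rw [mem_ofPred, mem_ofPred, hw, sum_incidenceVector_apply, add_le_add_iff_right]
  have hcomp := hS.component_biUnion (T := T.filter (Maximal fun X => X ∈ T ∧
    r ≤ ∑ Y ∈ T with X ≤ Y, c Y)) (fun X hX => hTS (Finset.mem_filter.1 hX).1)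
    (fun X hX Y hY hne h => hne (h.antisymm
      ((Finset.mem_filter.1 hX).2.2 (Finset.mem_filter.1 hY).2.1 h)))
  have hXmem : X ∈ T.filter (Maximal fun X => X ∈ T ∧ r ≤ ∑ Y ∈ T with X ≤ Y, c Y) := by
    refine Finset.mem_filter.2 ⟨hX, ⟨hX, le_rfl⟩, fun Y hY hXY => ?_⟩
    by_contra hYX
    have hsub : insert X (T.filter fun Z => Y ≤ Z) ⊆ T.filter fun Z => X ≤ Z := by
      refine Finset.insert_subset (Finset.mem_filter.2 ⟨hX, le_rfl⟩) fun Z hZ => ?_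
      have hZ' := Finset.mem_filter.1 hZ
      exact Finset.mem_filter.2 ⟨hZ'.1, hXY.trans hZ'.2⟩
    have := Finset.sum_le_sum_of_subset_of_nonneg hsub fun Z hZ _ => hpos X Z hZ
    rw [Finset.sum_insert fun h => hYX (Finset.mem_filter.1 h).2] at this
    linarith [hY.2, hc X hX]
  obtain ⟨e, he⟩ := (isConnectedElement_iff.1 (hS.1 (hTS hX))).1
  refine ⟨r + t₀, e, ?_, ?_⟩
  · have : e ∈ {e | r + t₀ ≤ w e} := by
      rw [hlev, hS.level_eq hTS hc hr]
      exact mem_iUnion₂.2 ⟨X, hXmem, he⟩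
    exact this
  · rw [hlev, hS.level_eq hTS hc hr]
    exact (hcomp.2 X hXmem e he).symm

end NestedWeights

/-! ### Disconnected intervals -/

/-- The number of elements of a component of `M[F, G]` in an independent set that spans `F` and `G`
is its rank. -/
theorem ncard_inter_component_le [Finite α] {M : Matroid α} {F G B B' : Set α} (hFG : F ⊆ G)
    (hG : G ⊆ M.E) (hB : M.Indep B) (hBF : Spans M B F) (hBG : Spans M B G) (hB' : M.Indep B')
    (hBF' : Spans M B' F) (e : α) :
    (B' ∩ component (interval M F G) e).ncard ≤ (B ∩ component (interval M F G) e).ncard := by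
  have hind : ∀ D, M.Indep D → Spans M D F → (interval M F G).Indep (D ∩ (G \ F)) := by
    intro D hD hDF
    have hb : (M ↾ G).IsBasis (D ∩ F) F :=
      (Matroid.isBasis_restrict_iff hG).2 ⟨hDF.isBasis hD, hFG⟩
    refine hb.contract_indep_iff.2 ⟨Matroid.restrict_indep_iff.2
      ⟨hD.subset (union_subset inter_subset_left inter_subset_left), ?_⟩, ?_⟩
    · exact union_subset (inter_subset_right.trans sdiff_subset) (inter_subset_right.trans hFG)
    · exact disjoint_sdiff_right.mono_right inter_subset_right
  have hsp : Spans (interval M F G) (B ∩ (G \ F)) (G \ F) := by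
    rintro g ⟨hgG, hgF⟩
    have hsub : B ∩ (G \ F) ∩ (G \ F) ∪ F ⊆ G :=
      union_subset ((inter_subset_left.trans inter_subset_right).trans sdiff_subset) hFG
    rw [interval, Matroid.contract_closure_eq, Matroid.restrict_closure_eq _ hsub hG]
    refine ⟨⟨M.closure_subset_closure (fun a ha => ?_) (hBG hgG), hgG⟩, hgF⟩
    by_cases haF : a ∈ F
    · exact Or.inr haF
    · exact Or.inl ⟨⟨ha.1, ha.2, haF⟩, ha.2, haF⟩
  have hcc : CircuitClosed (interval M F G) (G \ F) (component (interval M F G) e) :=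
    ⟨component_subset_ground _ e, fun C hC _ ⟨f, hfC, hf⟩ => circuit_subset_component hC hfC hf⟩
  have hinter : ∀ D : Set α, D ∩ (G \ F) ∩ component (interval M F G) e =
      D ∩ component (interval M F G) e := fun D => by
    rw [inter_assoc, inter_eq_self_of_subset_right (s := G \ F)
      (component_subset_ground (interval M F G) e)]
  have := (hsp.circuitClosed (X := G \ F) Subset.rfl hcc).ncard_inter_le
    (hind B hB hBF) (hind B' hB' hBF')
  rwa [hinter, hinter] at this

/-! ### Comparison of the two complexes -/

section Comparison

variable [Fintype α] {M : Matroid α} {w : α → ℝ}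

/-- A nonconstant point of the cone of `w` is a positive multiple of a point of the sphere, up to
adding a constant. So it lies in each nested cone that has the same intersection with the
sphere. -/
theorem mem_nestedCone_of_maxBases_subset {S : Set (Flats M)}
    (hS : sphericalSimplex S = normalCone M w ∩ sphere α) {x : α → ℝ}
    (hx : maxBases M w ⊆ maxBases M x) {e f : α} (hef : x e ≠ x f) : x ∈ nestedCone S := by
  set n : ℝ := (Fintype.card α : ℝ) with hn
  have hn0 : n ≠ 0 := by
    have : Nonempty α := ⟨e⟩
    simp [hn]
  set m : ℝ := (∑ i, x i) / n with hm
  set q : ℝ := ∑ i, (x i - m) ^ 2 with hq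
  have hq0 : 0 < q := by
    refine (Finset.sum_nonneg fun i _ => sq_nonneg _).lt_of_ne fun h => hef ?_
    have := (Finset.sum_eq_zero_iff_of_nonneg fun i _ => sq_nonneg (x i - m)).1 h.symm
    have he := pow_eq_zero_iff (two_ne_zero) |>.1 (this e (Finset.mem_univ e))
    have hf := pow_eq_zero_iff (two_ne_zero) |>.1 (this f (Finset.mem_univ f))
    linarith
  have hs0 : 0 < Real.sqrt q := Real.sqrt_pos.2 hq0
  set z : α → ℝ := (Real.sqrt q)⁻¹ • (x + fun _ => -m) with hz
  have hzi : ∀ i, z i = (Real.sqrt q)⁻¹ * (x i - m) := fun i => by simp [hz]; ring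
  have hzs : z ∈ sphere α := by
    constructor
    · simp only [hzi]
      rw [← Finset.mul_sum, Finset.sum_sub_distrib, Finset.sum_const, Finset.card_univ,
        nsmul_eq_mul, ← hn, hm, mul_div_cancel₀ _ hn0, sub_self, mul_zero]
    · simp only [hzi, mul_pow]
      rw [← Finset.mul_sum, ← hq, inv_pow, Real.sq_sqrt hq0.le, inv_mul_cancel₀ hq0.ne']
  have hzc : z ∈ normalCone M w := by
    rw [normalCone_eq]
    refine fun B hB => ⟨hB.1, fun B' hB' => ?_⟩
    rw [hz, cost_smul, cost_smul, cost_add, cost_add, cost_const, cost_const,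
      hB'.ncard_eq_ncard_of_isBase hB.1]
    refine mul_le_mul_of_nonneg_left ?_ (inv_nonneg.2 hs0.le)
    linarith [(hx hB).2 B' hB']
  have hzS : z ∈ sphericalSimplex S := hS ▸ ⟨hzc, hzs⟩
  rw [sphericalSimplex_eq] at hzS
  have hxz : x = Real.sqrt q • z + fun _ => m := by
    ext i
    rw [Pi.add_apply, Pi.smul_apply, hzi, smul_eq_mul, mul_inv_cancel_left₀ hs0.ne']
    ring
  rw [hxz]
  exact add_mem_nestedCone (smul_mem_nestedCone hs0.le hzS.1) (const_mem_nestedCone S m)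

/-- If every interval of flats with connected upper end is connected, then each cone
of the Bergman fan is the cone of the nested set of the level components of its interior points. -/
theorem nestedSphericalComplex_eq_of_isConnected_interval [M.Loopless] (hE : M.E = univ)
    (hM : IsConnected M)
    (hH : ∀ F G : Set α, M.IsFlat F → M.IsFlat G → F ⊂ G → IsConnected (M ↾ G) →
      IsConnected (interval M F G)) :
    nestedSphericalComplex M = bergmanComplex M := by
  classical
  refine Set.Subset.antisymm ?_ ?_
  · rintro _ ⟨S, hS, rfl⟩
    obtain ⟨htop, hS⟩ := hS
    have hS' := hS.mono (subset_insert ⊤ S)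
    let T := (toFinite S).toFinset
    have hT : ∀ X, X ∈ T ↔ X ∈ S := fun X => Set.Finite.mem_toFinset _
    have hTS : (T : Set (Flats M)) ⊆ S := fun X hX => (hT X).1 hX
    let w : α → ℝ := ∑ X ∈ T, (1 : ℝ) • incidenceVector X + fun _ => 0
    have hlev := hS'.component_level hE hM hTS (c := fun _ => 1) (fun _ _ => one_pos)
      (w := w) (t₀ := 0) rfl
    have hw : w ∈ bergmanFan M := mem_bergmanFan_of_isFlat_level fun t => (hlev t).1
    have hLC : levelComponents M w \ {⊤} = S := by
      refine Set.Subset.antisymm ?_ fun X hX => ⟨?_, fun h => htop (h ▸ hX)⟩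
      · rintro X ⟨⟨t, e, he, hX⟩, hXtop⟩
        obtain ⟨Y, hY, hYT⟩ := (hlev t).2 e he
        obtain rfl : X = Y := Subtype.ext (hX.trans hY.symm)
        exact (hT X).1 (hYT.resolve_right hXtop)
      · exact hS'.mem_levelComponents hTS (c := fun _ => 1) (fun _ _ => one_pos)
          (w := w) (t₀ := 0) rfl ((hT X).2 hX)
    exact ⟨w, hw, by rw [sphericalSimplex_eq, normalCone_eq_nestedCone hE hH hw, hLC]⟩
  · rintro _ ⟨w, hw, rfl⟩
    exact ⟨_, levelComponents_diff_top_mem hE hM hw, by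
      rw [sphericalSimplex_eq, normalCone_eq_nestedCone hE hH hw]⟩

/-- If `M[F, G]` has a component `A` other than `G \ F`, then the cone of `v_F + v_G` contains
`v_F + v_G ± c v_A` for small `c`, although no nested set has these three points in its cone:
the flats that contribute to them would be components of `F`, of `G` or of the ground set, so that
the incidence vector of `A` would be constant on `G \ F`. -/
theorem isConnected_interval_of_nestedSphericalComplex_eq [M.Loopless] (hE : M.E = univ)
    (hM : IsConnected M) (h : nestedSphericalComplex M = bergmanComplex M) {F G : Set α}
    (hF : M.IsFlat F) (hG : M.IsFlat G) (hFG : F ⊂ G) (hGc : IsConnected (M ↾ G)) :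
    IsConnected (interval M F G) := by
  classical
  obtain ⟨g₀, hg₀G, hg₀F⟩ := exists_of_ssubset hFG
  refine ⟨⟨g₀, hg₀G, hg₀F⟩, fun e he f hf => ?_⟩
  by_contra hcon
  set A := component (interval M F G) e with hA
  have heA : e ∈ A := mem_component_self he
  have hfA : f ∉ A := fun h => hcon h.2
  obtain ⟨x₀, hx₀⟩ : F.Nonempty := by
    by_contra hF0
    rw [not_nonempty_iff_eq_empty] at hF0
    subst hF0
    refine hcon (hGc.2 e he.1 f hf.1 |>.imp id ?_)
    rintro ⟨C, hC, hC'⟩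
    exact ⟨C, by rwa [interval, Matroid.contract_empty], hC'⟩
  let w : α → ℝ := F.indicator 1 + G.indicator 1
  have hwF : ∀ a ∈ F, w a = 2 := fun a ha => by
    have := hFG.1 ha
    simp [w, ha, this]; norm_num
  have hwG : ∀ a ∈ G, a ∉ F → w a = 1 := fun a ha ha' => by simp [w, ha, ha']
  have hw0 : ∀ a, a ∉ G → w a = 0 := fun a ha => by
    have : a ∉ F := fun h => ha (hFG.1 h)
    simp [w, ha, this]
  have hlevel : ∀ t, {a | t ≤ w a} = univ ∨ {a | t ≤ w a} = G ∨ {a | t ≤ w a} = F ∨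
      {a | t ≤ w a} = ∅ := by
    intro t
    have hval : ∀ a, (a ∈ F ∧ a ∈ G ∧ w a = 2) ∨ (a ∉ F ∧ a ∈ G ∧ w a = 1) ∨
        (a ∉ F ∧ a ∉ G ∧ w a = 0) := fun a => by
      by_cases h1 : a ∈ F
      · exact Or.inl ⟨h1, hFG.1 h1, hwF a h1⟩
      by_cases h2 : a ∈ G
      · exact Or.inr (Or.inl ⟨h1, h2, hwG a h2 h1⟩)
      · exact Or.inr (Or.inr ⟨h1, h2, hw0 a h2⟩)
    obtain ht | ht := le_or_gt t 0
    · refine Or.inl (eq_univ_of_forall fun a => ?_)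
      rw [mem_ofPred]
      obtain h | h | h := hval a <;> linarith [h.2.2]
    obtain ht1 | ht1 := le_or_gt t 1
    · refine Or.inr (Or.inl (Set.ext fun a => ?_))
      rw [mem_ofPred]
      obtain h | h | h := hval a <;> simp only [h.2.1, h.2.2, iff_true, iff_false] <;> linarith
    obtain ht2 | ht2 := le_or_gt t 2
    · refine Or.inr (Or.inr (Or.inl (Set.ext fun a => ?_)))
      rw [mem_ofPred]
      obtain h | h | h := hval a <;> simp only [h.1, h.2.2, iff_true, iff_false] <;> linarith
    · refine Or.inr (Or.inr (Or.inr (eq_empty_of_forall_notMem fun a ha => ?_)))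
      rw [mem_ofPred] at ha
      obtain h | h | h := hval a <;> linarith [h.2.2]
  have hw : w ∈ bergmanFan M := mem_bergmanFan_of_isFlat_level fun t => by
    obtain h | h | h | h := hlevel t <;> rw [h]
    exacts [hE ▸ M.ground_isFlat, hG, hF, isFlat_empty M]
  have hspF : ∀ B ∈ maxBases M w, Spans M B F := fun B hB =>
    spans_of_mem_maxBases hB hF.subset_ground fun a ha b hb => by
      rw [hwF a ha]
      by_cases hbG : b ∈ G
      · rw [hwG b hbG hb]; norm_num
      · rw [hw0 b hbG]; norm_num
  have hspG : ∀ B ∈ maxBases M w, Spans M B G := fun B hB =>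
    spans_of_mem_maxBases hB hG.subset_ground fun a ha b hb => by
      rw [hw0 b hb]
      by_cases haF : a ∈ F
      · rw [hwF a haF]; norm_num
      · rw [hwG a ha haF]; norm_num
  have hle : ∀ B ∈ maxBases M w, ∀ B' ∈ maxBases M w, (B' ∩ A).ncard ≤ (B ∩ A).ncard :=
    fun B hB B' hB' => ncard_inter_component_le hFG.1 hG.subset_ground hB.1.indep (hspF B hB)
      (hspG B hB) hB'.1.indep (hspF B' hB') e
  obtain ⟨c, hc0, hc1, hplus, hminus⟩ := exists_pos_maxBases_subset (M := M) (w := w)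
    (u := A.indicator 1) fun B hB B' hB' => by
      rw [cost_indicator, cost_indicator, (hle B hB B' hB').antisymm (hle B' hB' B hB)]
  obtain ⟨S, ⟨-, hS⟩, hSw⟩ : normalCone M w ∩ sphere α ∈ nestedSphericalComplex M :=
    h ▸ ⟨w, hw, rfl⟩
  have hS' := hS.mono (subset_insert ⊤ S)
  have hx₀A : x₀ ∉ A := fun hx => (component_subset_ground _ e hx).2 hx₀
  have hwx : w x₀ = 2 := hwF x₀ hx₀
  have hwe : w e = 1 := hwG e he.1 he.2
  have hwf : w f = 1 := hwG f hf.1 hf.2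
  have hp : w + c • A.indicator 1 ∈ nestedCone S :=
    mem_nestedCone_of_maxBases_subset hSw hplus (e := x₀) (f := e) (by
      simp [hx₀A, heA, hwx, hwe]; linarith)
  have hm : w + (-c) • A.indicator 1 ∈ nestedCone S :=
    mem_nestedCone_of_maxBases_subset hSw hminus (e := x₀) (f := e) (by
      simp [hx₀A, heA, hwx, hwe]; linarith)
  let T := (toFinite S).toFinset
  have hT : ∀ X, X ∈ T ↔ X ∈ S := fun X => Set.Finite.mem_toFinset _
  obtain ⟨a, s, ha, hpa⟩ := exists_eq_sum_of_mem_nestedCone (T := T) (fun X hX => (hT X).2 hX) hp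
  obtain ⟨b, t, hb, hmb⟩ := exists_eq_sum_of_mem_nestedCone (T := T) (fun X hX => (hT X).2 hX) hm
  -- `w` is the mean of the two points, a positive combination over the flats that contribute
  let T' := T.filter fun X => 0 < a X + b X
  have hsum : w = ∑ X ∈ T', ((a X + b X) / 2) • incidenceVector X + fun _ => (s + t) / 2 := by
    ext i
    have h1 := congrFun hpa i
    have h2 := congrFun hmb i
    have h3 : ∑ X ∈ T', ((a X + b X) / 2) * (incidenceVector X : α → ℝ) i =
        ∑ X ∈ T, ((a X + b X) / 2) * (incidenceVector X : α → ℝ) i := by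
      refine Finset.sum_filter_of_ne fun X _ hX => ?_
      refine (add_nonneg (ha X) (hb X)).lt_of_ne fun h0 => hX ?_
      rw [← h0]; simp
    have h4 : ∑ X ∈ T, ((a X + b X) / 2) * (incidenceVector X : α → ℝ) i =
        (∑ X ∈ T, a X * (incidenceVector X : α → ℝ) i +
          ∑ X ∈ T, b X * (incidenceVector X : α → ℝ) i) / 2 := by
      rw [← Finset.sum_add_distrib, Finset.sum_div]
      exact Finset.sum_congr rfl fun X _ => by ring
    simp only [Pi.add_apply, Pi.smul_apply, Finset.sum_apply, smul_eq_mul] at h1 h2 ⊢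
    rw [h3, h4]
    linarith
  have hconst : ∀ X ∈ T', (incidenceVector X : α → ℝ) e = incidenceVector X f := by
    intro X hX
    obtain ⟨r, g, hg, hXg⟩ := hS'.mem_levelComponents (T := T')
      (fun Y hY => (hT Y).1 (Finset.mem_filter.1 hY).1) (c := fun X => (a X + b X) / 2)
      (fun Y hY => half_pos (Finset.mem_filter.1 hY).2) hsum hX
    have hgL : g ∈ {i | r ≤ w i} := hg
    have hXL : X.1 ⊆ {i | r ≤ w i} := hXg ▸ component_restrict_subset M _ g
    obtain hL | hL | hL | hL := hlevel r
    · rw [hL, ← hE] at hXg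
      rw [component_eq_self Subset.rfl (isConnected_restrict_top hM) (hE ▸ mem_univ g)] at hXg
      rw [incidenceVector, hXg, indicator_of_mem (hE ▸ mem_univ e : e ∈ M.E),
        indicator_of_mem (hE ▸ mem_univ f : f ∈ M.E)]
      rfl
    · rw [hL] at hXg hgL
      rw [component_eq_self hG.subset_ground hGc hgL] at hXg
      rw [incidenceVector, hXg, indicator_of_mem (s := G) he.1, indicator_of_mem (s := G) hf.1]
      rfl
    · rw [hL] at hXL
      rw [incidenceVector, indicator_of_notMem fun h => he.2 (hXL h),
        indicator_of_notMem fun h => hf.2 (hXL h)]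
    · rw [hL] at hgL
      exact hgL.elim
  have he1 := congrFun hpa e
  have hf1 := congrFun hpa f
  simp only [Pi.add_apply, Pi.smul_apply, Finset.sum_apply, smul_eq_mul,
    indicator_of_mem heA, indicator_of_notMem hfA, hwe, hwf, Pi.one_apply] at he1 hf1
  have : ∑ X ∈ T, a X * (incidenceVector X : α → ℝ) e =
      ∑ X ∈ T, a X * (incidenceVector X : α → ℝ) f := by
    refine Finset.sum_congr rfl fun X hX => ?_
    by_cases hX' : X ∈ T'
    · rw [hconst X hX']
    · have : a X = 0 := by
        by_contra h0
        exact hX' (Finset.mem_filter.2 ⟨hX, add_pos_of_pos_of_nonneg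
          ((ha X).lt_of_ne (Ne.symm h0)) (hb X)⟩)
      rw [this, zero_mul, zero_mul]
  linarith

end Comparison

end BergmanNested

theorem theorem5p3 {α : Type*} [Fintype α] (M : Matroid α) (hE : M.E = Set.univ)
    (hM : BergmanNested.IsConnected M) :
    BergmanNested.nestedSphericalComplex M = BergmanNested.bergmanComplex M ↔
      ∀ F G : Set α, M.IsFlat F → M.IsFlat G → F ⊂ G →
        BergmanNested.IsConnected (M ↾ G) →
          BergmanNested.IsConnected (BergmanNested.interval M F G) := by
  open BergmanNested in
  by_cases hl : M.Loopless
  · exact ⟨fun h F G hF hG hFG hGc =>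
      isConnected_interval_of_nestedSphericalComplex_eq hE hM h hF hG hFG hGc,
      nestedSphericalComplex_eq_of_isConnected_interval hE hM⟩
  -- a connected matroid with a loop has no other element: its only flat is the ground set
  obtain ⟨e, heE, he⟩ : ∃ e ∈ M.E, M.IsLoop e := by
    rw [Matroid.loopless_iff_forall_not_isLoop] at hl
    push Not at hl
    exact hl
  have hground : M.E ⊆ M.closure ∅ := fun f hf => by
    obtain rfl | ⟨C, hC, heC, hfC⟩ := hM.2 e heE f hf
    · exact he
    · rw [he.eq_of_isCircuit_mem hC heC] at hfC
      exact hfC ▸ he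
  have hflat : ∀ F, M.IsFlat F → M.E ⊆ F := fun F hF =>
    hground.trans ((M.closure_subset_closure (Set.empty_subset F)).trans hF.closure.subset)
  refine iff_of_true ?_ fun F G hF hG hFG _ => (hFG.2 (hG.subset_ground.trans (hflat F hF))).elim
  have h1 : nestedSphericalComplex M = ∅ := by
    refine Set.eq_empty_of_forall_notMem ?_
    rintro _ ⟨S, ⟨-, hS⟩, -⟩
    have : (⊥ : Flats M) < ⊤ := (hS.1 (Set.mem_insert ⊤ S)).1
    exact this.not_ge (hflat _ (⊥ : Flats M).2)
  have h2 : bergmanComplex M = ∅ := by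
    refine Set.eq_empty_of_forall_notMem ?_
    rintro _ ⟨w, hw, -⟩
    obtain ⟨i, hi, j, hj, hij, -⟩ := hw {e} he.isCircuit
    exact hij (hi.trans hj.symm)
  rw [h1, h2]
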